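/- **Setting.** $\mathcal H$ is a finite-dimensional Hilbert space; a state is a positive semidefinite operator of trace one. For $A\ge 0$ with spectral projections $P_\lambda$ and $s\in\mathbb R$ put $A^s:=\sum_{\lambda\neq0}\lambda^sP_\lambda$ (so $A^{-1}$ is the generalized inverse and $A^0$ the support projection). $\|\cdot\|$ is the operator norm and $\|A\|_2=(\mathrm{Tr}A^*A)^{1/2}$. Every operator monotone decreasing $f:(0,\infty)\to\mathbb R$ has a unique representation $$f(x)=ax+b+\int_{[0,\infty)}\Big(\frac1{t+x}-\frac t{t^2+1}\Big)d\mu_f(t),\qquad a\le0,\ b\in\mathbb R,\ \int\frac{d\mu_f(t)}{t^2+1}<\infty .$$ For $\beta\in(0,1)$ and $T>0$ let $T_L=T$, $T_R=T^{\beta/(1-\beta)}$ if $\beta\le\frac12$, and $T_L=T^{(1-\beta)/\beta}$, $T_R=T$ if $\beta\ge\frac12$. Let $C^f_{T,\beta}\in[0,\infty]$ be the least constant with $dt\le C^f_{T,\beta}\,d\mu_f(t)$ on $[T_L^{-1},T_R]$; $f$ is called $C^f_{T,\beta}$-regular if it is operator monotone decreasing and $C^f_{T,\beta}<\infty$ for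 all $T>0$. For states $\rho,\sigma$, an operator $K$ and $f$ operator monotone decreasing with $f(1)=0$, let $\Delta_{\sigma,\rho}(X)=\sigma X\rho^{-1}$ and $$S_f^K(\rho\|\sigma)=\mathrm{Tr}\big(\sqrt\rho\,K^*f(\Delta_{\sigma,\rho})(K\sqrt\rho)\big),\qquad f(0):=\lim_{x\downarrow0}f(x),$$ where, if $f(0)=+\infty$, the value is $+\infty$ unless $K$ maps the support of $\rho$ into the support of $\sigma$; in that case the eigenvalue $0$ of $\Delta_{\sigma,\rho}$ does not contribute. (For invertible $\sigma$ none of these conventions is needed.) **Statement.** Let $\beta\in(0,1)$, let $f$ be $C^f_{T,\beta}$-regular with $f(1)=0$, and suppose that $C^f_{T,\beta}\le C\,T^{2c}$ for all $T>0$, with constants $C>0$, $c\ge0$. Let $K$ be an operator on $\mathcal H$, let $\rho=\sum_{j=1}^Np_j\rho_j$ and $\sigma=\sum_{j=1}^Np_j\sigma_j$ with states $\rho_j,\sigma_j$, $p_j>0$, $\sum_jp_j=1$, and let $S_f^K(\rho_j\|\sigma_j)<\infty$ for all $j$ (automatic if the $\sigma_j$ are invertible). Then $S_f^K(\rho\|\sigma)<\infty$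 and $$E:=\sum_jp_jS_f^K(\rho_j\|\sigma_j)-S_f^K(\rho\|\sigma)\ \ge 0 .$$ Let $\lambda_j$ and $\lambda$ be the smallest non-zero eigenvalues of $\rho_j$ and $\rho$, and put $$\alpha(\beta)=\begin{cases}\dfrac{\beta(1-\beta)}{1+2c(1-\beta)},&\beta\le\frac12,\\[2mm]\dfrac12\,\dfrac{1-\beta}{1+c},&\beta\ge\frac12,\end{cases}\qquad M(D)=\frac{\sin\beta\pi}{\pi}\sqrt N\left(\frac{2\|K\|}{\beta}+\frac{2\|K\|D}{1-\beta}+\sqrt C\right).$$ 1. If all $\rho_j$ have the same support (for instance, if all $\rho_j$ are invertible), then, with $M=M\big(\sum_jp_j^{-1}\lambda_j^{-1}\big)$, $$\sum_jp_j^{1/2}\big\|\sigma^\beta K\rho^{-\beta}\rho_j^{1/2}-\sigma_j^\beta K\rho_j^{1/2-\beta}\big\|_2\le M\,E^{\alpha(\beta)} .$$ 2. In particular, for $\beta=\frac12$ and invertible $\rho_j$, with the same $M$, $$\sum_jp_j^{1/2}\big\|\sigma^{1/2}K\rho^{-1/2}\rho_j^{1/2}-\sigma_j^{1/2}K\big\|_2\le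 M\,E^{\frac1{4(c+1)}} .$$ 3. For arbitrary states $\rho_j$ the inequality of 1 holds with $M=M\big(\lambda^{-1}+\sum_jp_j^{-1}\lambda_j^{-1}\big)$. -/

import Mathlib

open scoped Matrix ENNReal Topology ComplexOrder
open MeasureTheory Filter

/-! ### Operator monotone decreasing functions and their canonical measure -/

/-- `f : (0,∞) → ℝ` is operator monotone decreasing: if `A - B ≥ 0` for positive definite matrices
(self-adjoint with spectrum in `(0,∞)`) of any order, then `f(B) - f(A) ≥ 0`. -/
def OperatorMonotoneDecreasing (f : ℝ → ℝ) : Prop :=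
  ∀ (d : ℕ) (A B : Matrix (Fin d) (Fin d) ℂ), A.PosDef → B.PosDef →
    (A - B).PosSemidef → (cfc f B - cfc f A).PosSemidef

/-- `μ` is the measure on `[0,∞)` in the canonical integral representation
`f(x) = a x + b + ∫ (1/(t+x) - t/(t²+1)) dμ(t)`, `x > 0`, with `a ≤ 0`, `b` real and
`∫ 1/(t²+1) dμ(t) < ∞`. -/
def IsCanonicalMeasure (f : ℝ → ℝ) (μ : Measure ℝ) : Prop :=
  μ (Set.Iio 0) = 0 ∧ (∫⁻ t, ENNReal.ofReal (1 / (t ^ 2 + 1)) ∂μ) < ⊤ ∧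
    ∃ a b : ℝ, a ≤ 0 ∧
      ∀ x : ℝ, 0 < x → f x = a * x + b + ∫ t, (1 / (t + x) - t / (t ^ 2 + 1)) ∂μ

open Classical in
/-- The measure `μ_f` of the canonical integral representation of `f`.  It exists and is unique for
every operator monotone decreasing `f` (Löwner); the value `0` is used for all other `f`. -/
noncomputable def canonicalMeasure (f : ℝ → ℝ) : Measure ℝ :=
  if h : ∃ μ, IsCanonicalMeasure f μ then h.choose else 0

/-- `T_L(β) = T` for `β ≤ 1/2` and `T^{(1-β)/β}` for `β ≥ 1/2`. -/
noncomputable def cutL (β T : ℝ) : ℝ := if β ≤ 1 / 2 then T else T ^ ((1 - β) / β)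

/-- `T_R(β) = T^{β/(1-β)}` for `β ≤ 1/2` and `T` for `β ≥ 1/2`. -/
noncomputable def cutR (β T : ℝ) : ℝ := if β ≤ 1 / 2 then T ^ (β / (1 - β)) else T

/-- `C^f_{T,β}`: the least constant `c` with `dt ≤ c dμ_f(t)` on `[T_L(β)⁻¹, T_R(β)]`
(`⊤` if there is none; `0` if the interval has no interior, i.e. for `T ≤ 1`). -/
noncomputable def regularityConst (f : ℝ → ℝ) (β T : ℝ) : ℝ≥0∞ :=
  sInf {c : ℝ≥0∞ | (volume : Measure ℝ).restrict (Set.Icc (cutL β T)⁻¹ (cutR β T)) ≤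
    c • (canonicalMeasure f).restrict (Set.Icc (cutL β T)⁻¹ (cutR β T))}

/-- `f` is `C^f_{T,β}`-regular: operator monotone decreasing, and `C^f_{T,β}` is finite for every
`T > 0`. -/
def IsRegularFunction (f : ℝ → ℝ) (β : ℝ) : Prop :=
  OperatorMonotoneDecreasing f ∧ ∀ T : ℝ, 0 < T → regularityConst f β T < ⊤

/-! ### States, powers, norms -/

section Operators

variable {n : Type*} [Fintype n] [DecidableEq n]

/-- A state (density operator) on `ℂⁿ`. -/
def IsState (ρ : Matrix n n ℂ) : Prop := ρ.PosSemidef ∧ ρ.trace = 1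

/-- The power `A^s = ∑_{λ ≠ 0} λ^s P_λ` of a positive semidefinite `A`, any real `s`, taken on the
support of `A`.  So `A^{-1}` is the generalized inverse, `A^0` the support projection of `A`. -/
noncomputable def psdPow (A : Matrix n n ℂ) (s : ℝ) : Matrix n n ℂ :=
  cfc (fun x : ℝ => if x = 0 then 0 else x ^ s) A

/-- The Hilbert–Schmidt norm `(Tr A* A)^{1/2}`. -/
noncomputable def hsNorm (A : Matrix n n ℂ) : ℝ := √((Aᴴ * A).trace.re)

/-- The operator norm of `A` on the Hilbert space `ℂⁿ`. -/
noncomputable def opNorm (A : Matrix n n ℂ) : ℝ := ‖Matrix.toEuclideanCLM (n := n) (𝕜 := ℂ) A‖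

/-- The smallest non-zero eigenvalue of a nonzero positive semidefinite `A`. -/
noncomputable def minNonzeroEigenvalue (A : Matrix n n ℂ) : ℝ := sInf (spectrum ℝ A \ {0})

/-! ### The quasi-relative entropy -/

/-- The modular operator `Δ_{σ,ρ}(X) = σ X ρ⁻¹`, with the generalized inverse of `ρ`. -/
noncomputable def modularOperator (σ ρ : Matrix n n ℂ) : Matrix n n ℂ →ₗ[ℂ] Matrix n n ℂ :=
  LinearMap.mulLeft ℂ σ ∘ₗ LinearMap.mulRight ℂ (psdPow ρ (-1))

/-- Functional calculus `g(Φ)` for an operator `Φ` on the space of matrices that is self-adjoint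
for the Hilbert–Schmidt inner product, computed in the (orthonormal) basis of matrix units. -/
noncomputable def superFunction (g : ℝ → ℝ) (Φ : Matrix n n ℂ →ₗ[ℂ] Matrix n n ℂ) :
    Matrix n n ℂ →ₗ[ℂ] Matrix n n ℂ :=
  Matrix.toLin (Matrix.stdBasis ℂ n n) (Matrix.stdBasis ℂ n n)
    (cfc g (LinearMap.toMatrix (Matrix.stdBasis ℂ n n) (Matrix.stdBasis ℂ n n) Φ))

/-- `f` on `(0,∞)`, extended to `0` by `f(0) = lim_{x ↓ 0} f(x)`. -/
noncomputable def extendZero (f : ℝ → ℝ) (x : ℝ) : ℝ :=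
  if 0 < x then f x else limUnder (𝓝[>] (0 : ℝ)) f

open Classical in
/-- The quasi-relative entropy `S_f^K(ρ‖σ) = Tr(√ρ K* f(Δ_{σ,ρ})(K √ρ))`, with `f(0) = f(0+)`.
If `f(0+) = +∞`, then the value is `+∞` unless `K` maps the support of `ρ` into that of `σ`
(in which case the eigenvalue `0` of `Δ_{σ,ρ}` does not contribute).  For invertible `σ` this is
just the trace formula. -/
noncomputable def quasiRelEntropy (f : ℝ → ℝ) (K ρ σ : Matrix n n ℂ) : EReal :=
  if (∃ l : ℝ, Tendsto f (𝓝[>] (0 : ℝ)) (𝓝 l)) ∨ psdPow σ 0 * K * ρ = K * ρ then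
    (((psdPow ρ (1 / 2) * Kᴴ *
      superFunction (extendZero f) (modularOperator σ ρ) (K * psdPow ρ (1 / 2))).trace.re : ℝ) :
        EReal)
  else ⊤

end Operators

/-! ### The exponent and the constant -/

/-- The exponent `α(β)`, depending on `c`. -/
noncomputable def alphaExponent (c β : ℝ) : ℝ :=
  if β ≤ 1 / 2 then β * (1 - β) / (1 + 2 * c * (1 - β)) else 1 / 2 * ((1 - β) / (1 + c))

/-- The constant `M` for `N` summands, `κ = ‖K‖`. -/
noncomputable def errorConst (β C : ℝ) (N : ℕ) (κ D : ℝ) : ℝ :=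
  Real.sin (β * Real.pi) / Real.pi * √(N : ℝ) *
    (2 * κ / β + 2 * κ * D / (1 - β) + √C)

/-! In eigenbases of `ρ` and `σ` (eigenvalues `r_i`, `s_k`) the operator `Δ_{σ,ρ}` multiplies the
entry `(k, i)` of `K` by `s_k / r_i`. Entropies, resolvents and the products `σ^β K ρ^{-β}` are thus
all Schur multiples of `K`, and identities between them reduce to scalar ones.

The core is a quantitative joint convexity for `x ↦ 1/(t+x)`. Let `Y` solve `t Y ρ + σ Y = K ρ`, and
let `Y_j` solve the same equation for the pair `ρ_j, σ_j`. Expanding squares shows that the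
convexity defect of `1/(t+x)` equals `∑ p_j ⟨Y - Y_j, t (Y - Y_j) ρ_j + σ_j (Y - Y_j)⟩`, hence is at
least `t ∑ p_j ‖(Y - Y_j) ρ_j^{1/2}‖₂²` (`le_convexityGap_inv_add`). Constants have defect zero and
`x` has defect at most zero, so the canonical representation of `f` gives `E ≥ 0`. It also gives `∫
gap_t dt ≤ C T^{2c} E` over `[T_L⁻¹, T_R]`, because there `dt` is dominated by `C T^{2c} dμ_f` up to
an arbitrarily small increase of `C` (`setIntegral_convexityGap_le`). As `f` may blow up at `0`,
this is done for `f(· + ε)`, followed by `ε → 0`.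

On the other side, `x^β = (sin βπ / π) ∫ t^β (1/t - 1/(t+x)) dt` turns the operators to be estimated
into integrals of `t^β (Y - Y_j) ρ_j^{1/2}` (`hsNorm_psdPow_sub_le`). The integral is cut at `T_L⁻¹`
and `T_R`. Near `0` the resolvents are `O(1/t)`; near infinity their leading terms cancel and leave
`O(1/t²)`, at the price of inverse smallest eigenvalues; in the middle Cauchy–Schwarz brings in the
defect and thereby `E`. A power of `E` as cutoff makes all three parts of order `E^α`
(`exists_cutoff`). -/

/-! ### Schur multipliers in the eigenbases of `ρ` and `σ`. -/

section Schur

variable {n : Type*} [Fintype n] [DecidableEq n] {σ ρ : Matrix n n ℂ}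

/-- The matrix of `K` in the eigenbases of `ρ` (source) and `σ` (target). -/
noncomputable def eigCoeff (hσ : σ.IsHermitian) (hρ : ρ.IsHermitian) (K : Matrix n n ℂ) :
    Matrix n n ℂ :=
  star (hσ.eigenvectorUnitary : Matrix n n ℂ) * K * (hρ.eigenvectorUnitary : Matrix n n ℂ)

/-- The squared moduli of the matrix elements of `K` in the eigenbases of `ρ` and `σ`. -/
noncomputable def eigWeight (hσ : σ.IsHermitian) (hρ : ρ.IsHermitian) (K : Matrix n n ℂ)
    (k i : n) : ℝ := Complex.normSq (eigCoeff hσ hρ K k i)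

/-- Schur multiplication of `K` by `h` in the eigenbases of `ρ` and `σ`. -/
noncomputable def schurMul (hσ : σ.IsHermitian) (hρ : ρ.IsHermitian) (K : Matrix n n ℂ)
    (h : n → n → ℝ) : Matrix n n ℂ :=
  (hσ.eigenvectorUnitary : Matrix n n ℂ) *
    Matrix.of (fun k i => (h k i : ℂ) * eigCoeff hσ hρ K k i) *
    star (hρ.eigenvectorUnitary : Matrix n n ℂ)

variable (hσ : σ.IsHermitian) (hρ : ρ.IsHermitian) (K : Matrix n n ℂ)

lemma eigWeight_nonneg (k i : n) : 0 ≤ eigWeight hσ hρ K k i := Complex.normSq_nonneg _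

lemma Matrix.IsHermitian.cfc_eq_conj (hρ : ρ.IsHermitian) (g : ℝ → ℝ) :
    cfc g ρ = (hρ.eigenvectorUnitary : Matrix n n ℂ) *
      Matrix.diagonal (fun i => (g (hρ.eigenvalues i) : ℂ)) *
      star (hρ.eigenvectorUnitary : Matrix n n ℂ) := by
  rw [hρ.cfc_eq, Matrix.IsHermitian.cfc, Unitary.conjStarAlgAut_apply]
  rfl

lemma schurMul_one : schurMul hσ hρ K (fun _ _ => 1) = K := by
  have : (Matrix.of fun k i => ((1 : ℝ) : ℂ) * eigCoeff hσ hρ K k i) = eigCoeff hσ hρ K := by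
    ext k i; simp
  rw [schurMul, this, eigCoeff]
  have h1 : (hσ.eigenvectorUnitary : Matrix n n ℂ) * star (hσ.eigenvectorUnitary : Matrix n n ℂ)
    = 1 := Unitary.coe_mul_star_self _
  have h2 : (hρ.eigenvectorUnitary : Matrix n n ℂ) * star (hρ.eigenvectorUnitary : Matrix n n ℂ)
    = 1 := Unitary.coe_mul_star_self _
  simp only [← mul_assoc]
  rw [h1, one_mul, mul_assoc, h2, mul_one]

lemma cfc_mul_schurMul (g : ℝ → ℝ) (h : n → n → ℝ) :
    cfc g σ * schurMul hσ hρ K h =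
      schurMul hσ hρ K (fun k i => g (hσ.eigenvalues k) * h k i) := by
  have h1 : star (hσ.eigenvectorUnitary : Matrix n n ℂ) * (hσ.eigenvectorUnitary : Matrix n n ℂ)
    = 1 := Unitary.coe_star_mul_self _
  rw [hσ.cfc_eq_conj, schurMul, schurMul]
  simp only [← mul_assoc]
  rw [mul_assoc _ (star _) _, h1, mul_one, mul_assoc _ (Matrix.diagonal _) _]
  congr 2
  ext k i
  simp [Matrix.diagonal_mul, mul_assoc]

lemma schurMul_mul_cfc (g : ℝ → ℝ) (h : n → n → ℝ) :
    schurMul hσ hρ K h * cfc g ρ =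
      schurMul hσ hρ K (fun k i => h k i * g (hρ.eigenvalues i)) := by
  have h1 : star (hρ.eigenvectorUnitary : Matrix n n ℂ) * (hρ.eigenvectorUnitary : Matrix n n ℂ)
    = 1 := Unitary.coe_star_mul_self _
  rw [hρ.cfc_eq_conj, schurMul, schurMul]
  simp only [← mul_assoc]
  rw [mul_assoc _ (star _) _, h1, mul_one, mul_assoc _ _ (Matrix.diagonal _)]
  congr 2
  ext k i
  simp [Matrix.mul_diagonal]
  ring

lemma mul_schurMul (h : n → n → ℝ) :
    σ * schurMul hσ hρ K h = schurMul hσ hρ K (fun k i => hσ.eigenvalues k * h k i) := by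
  have := cfc_mul_schurMul hσ hρ K id h
  rwa [cfc_id ℝ σ hσ.isSelfAdjoint] at this

lemma schurMul_mul (h : n → n → ℝ) :
    schurMul hσ hρ K h * ρ = schurMul hσ hρ K (fun k i => h k i * hρ.eigenvalues i) := by
  have := schurMul_mul_cfc hσ hρ K id h
  rwa [cfc_id ℝ ρ hρ.isSelfAdjoint] at this

lemma mul_cfc_eq_schurMul (g : ℝ → ℝ) :
    K * cfc g ρ = schurMul hσ hρ K (fun _ i => g (hρ.eigenvalues i)) := by
  have := schurMul_mul_cfc hσ hρ K g (fun _ _ => 1)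
  simpa [schurMul_one] using this

lemma mul_eq_schurMul : K * ρ = schurMul hσ hρ K (fun _ i => hρ.eigenvalues i) := by
  have := mul_cfc_eq_schurMul hσ hρ K id
  rwa [cfc_id ℝ ρ hρ.isSelfAdjoint] at this

lemma schurMul_add (h h' : n → n → ℝ) :
    schurMul hσ hρ K h + schurMul hσ hρ K h' = schurMul hσ hρ K (fun k i => h k i + h' k i) := by
  rw [schurMul, schurMul, schurMul, ← add_mul, ← mul_add]
  congr 2
  ext k i
  simp [add_mul]

lemma schurMul_smul (a : ℝ) (h : n → n → ℝ) :
    a • schurMul hσ hρ K h = schurMul hσ hρ K (fun k i => a * h k i) := by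
  rw [schurMul, schurMul, ← smul_mul_assoc, ← mul_smul_comm]
  congr 2
  ext k i
  simp [mul_assoc]

lemma schurMul_sub (h h' : n → n → ℝ) :
    schurMul hσ hρ K h - schurMul hσ hρ K h' = schurMul hσ hρ K (fun k i => h k i - h' k i) := by
  rw [schurMul, schurMul, schurMul, ← sub_mul, ← mul_sub]
  congr 2
  ext k i
  simp [sub_mul]

lemma schurMul_eq_sum (h : n → n → ℝ) : schurMul hσ hρ K h = ∑ k, ∑ i, h k i •
    ((hσ.eigenvectorUnitary : Matrix n n ℂ) * Matrix.single k i (eigCoeff hσ hρ K k i) *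
      star (hρ.eigenvectorUnitary : Matrix n n ℂ)) := by
  rw [schurMul, Matrix.matrix_eq_sum_single (Matrix.of _), Matrix.mul_sum, Matrix.sum_mul]
  refine Finset.sum_congr rfl fun k _ => ?_
  rw [Matrix.mul_sum, Matrix.sum_mul]
  refine Finset.sum_congr rfl fun i _ => ?_
  rw [← smul_mul_assoc, ← mul_smul_comm, Matrix.smul_single]
  simp

/-- The unitaries cancel under the trace, so Schur multiples pair like functions on index pairs
weighted by `|⟨k|K|i⟩|²`. Every trace and norm in the proof is computed this way. -/
lemma trace_schurMul_conjTranspose_mul (h h' : n → n → ℝ) :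
    ((schurMul hσ hρ K h)ᴴ * schurMul hσ hρ K h').trace.re =
      ∑ k, ∑ i, h k i * h' k i * eigWeight hσ hρ K k i := by
  have h1 : star (hσ.eigenvectorUnitary : Matrix n n ℂ) * (hσ.eigenvectorUnitary : Matrix n n ℂ)
    = 1 := Unitary.coe_star_mul_self _
  have h2 : star (hρ.eigenvectorUnitary : Matrix n n ℂ) * (hρ.eigenvectorUnitary : Matrix n n ℂ)
    = 1 := Unitary.coe_star_mul_self _
  rw [schurMul, schurMul]
  simp only [Matrix.star_eq_conjTranspose, Matrix.conjTranspose_mul,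
    Matrix.conjTranspose_conjTranspose] at h1 h2 ⊢
  rw [Matrix.trace_mul_comm]
  simp only [mul_assoc]
  rw [← mul_assoc (Matrix.conjTranspose _) (hρ.eigenvectorUnitary : Matrix n n ℂ), h2, one_mul,
    Matrix.trace_mul_comm]
  simp only [mul_assoc]
  rw [h1, mul_one, Matrix.trace_mul_comm]
  simp only [Matrix.trace, Matrix.diag_apply, Matrix.mul_apply, Matrix.conjTranspose_apply,
    Matrix.of_apply, Complex.re_sum]
  rw [Finset.sum_comm]
  refine Finset.sum_congr rfl fun k _ => Finset.sum_congr rfl fun i _ => ?_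
  simp [eigWeight, Complex.normSq_apply]
  ring

lemma hsNorm_sq {m : Type*} [Fintype m] (A : Matrix m m ℂ) : hsNorm A ^ 2 = (Aᴴ * A).trace.re := by
  rw [hsNorm, Real.sq_sqrt]
  exact (Complex.le_def.mp (Matrix.posSemidef_conjTranspose_mul_self A).trace_nonneg).1

lemma hsNorm_schurMul_sq (h : n → n → ℝ) :
    hsNorm (schurMul hσ hρ K h) ^ 2 = ∑ k, ∑ i, h k i ^ 2 * eigWeight hσ hρ K k i := by
  rw [hsNorm_sq, trace_schurMul_conjTranspose_mul]
  simp only [sq]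

/-! ### The functional calculus of the modular operator -/

lemma modularOperator_schurMul (h : n → n → ℝ) :
    modularOperator σ ρ (schurMul hσ hρ K h) = schurMul hσ hρ K
      (fun k i => (if hρ.eigenvalues i = 0 then 0 else hσ.eigenvalues k / hρ.eigenvalues i)
        * h k i) := by
  simp only [modularOperator, LinearMap.comp_apply, LinearMap.mulLeft_apply,
    LinearMap.mulRight_apply, psdPow]
  rw [schurMul_mul_cfc hσ, mul_schurMul]
  congr
  ext k i
  split_ifs
  · simp
  · rw [Real.rpow_neg_one]; ring

lemma toMatrix_modularOperator_isHermitian (ρ : Matrix n n ℂ) (hσ : σ.IsHermitian) :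
    (LinearMap.toMatrix (Matrix.stdBasis ℂ n n) (Matrix.stdBasis ℂ n n)
      (modularOperator σ ρ)).IsHermitian := by
  have hp : (psdPow ρ (-1)).IsHermitian := cfc_predicate _ ρ
  ext ⟨i, j⟩ ⟨k, l⟩
  have key : ∀ a b c d : n, LinearMap.toMatrix (Matrix.stdBasis ℂ n n) (Matrix.stdBasis ℂ n n)
      (modularOperator σ ρ) (a, b) (c, d) = σ a c * psdPow ρ (-1) d b := by
    intro a b c d
    rw [LinearMap.toMatrix_apply, Matrix.stdBasis_eq_single]
    have : ∀ M : Matrix n n ℂ, (Matrix.stdBasis ℂ n n).repr M (a, b) = M a b := by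
      intro M
      simp [Matrix.stdBasis]
    rw [this]
    simp [modularOperator, Matrix.mul_apply, Matrix.single_apply, ite_and]
  rw [Matrix.conjTranspose_apply, key, key, star_mul', ← hσ.apply k i, ← hp.apply l j]
  simp

lemma aeval_modularOperator_schurMul (q : Polynomial ℝ) (h : n → n → ℝ) :
    Polynomial.aeval (modularOperator σ ρ) q (schurMul hσ hρ K h) = schurMul hσ hρ K
      (fun k i => q.eval (if hρ.eigenvalues i = 0 then 0 else
        hσ.eigenvalues k / hρ.eigenvalues i) * h k i) := by
  induction q using Polynomial.induction_on' generalizing h with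
  | add p q hp hq =>
    rw [map_add, LinearMap.add_apply, hp, hq, schurMul_add]
    simp only [Polynomial.eval_add, add_mul]
  | monomial m a =>
    rw [Polynomial.aeval_monomial, Module.End.mul_apply, Module.algebraMap_end_apply]
    have : ∀ h, (modularOperator σ ρ ^ m) (schurMul hσ hρ K h) = schurMul hσ hρ K
        (fun k i => (if hρ.eigenvalues i = 0 then 0 else
          hσ.eigenvalues k / hρ.eigenvalues i) ^ m * h k i) := by
      induction m with
      | zero => intro h; simp
      | succ m ih =>
        intro h
        rw [pow_succ, Module.End.mul_apply, modularOperator_schurMul, ih]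
        simp only [pow_succ, mul_assoc]
    rw [this, schurMul_smul]
    simp only [Polynomial.eval_monomial, mul_assoc]

/-- On a finite spectrum `g` agrees with an interpolating polynomial, and powers of `Δ` act
entrywise. -/
lemma superFunction_modularOperator_schurMul (g : ℝ → ℝ) (h : n → n → ℝ) :
    superFunction g (modularOperator σ ρ) (schurMul hσ hρ K h) = schurMul hσ hρ K
      (fun k i => g (if hρ.eigenvalues i = 0 then 0 else hσ.eigenvalues k / hρ.eigenvalues i)
        * h k i) := by
  have hH := toMatrix_modularOperator_isHermitian ρ hσ
  set M := LinearMap.toMatrix (Matrix.stdBasis ℂ n n) (Matrix.stdBasis ℂ n n)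
      (modularOperator σ ρ) with hM
  let φ : n × n → ℝ := fun x => if hρ.eigenvalues x.2 = 0 then 0 else
    hσ.eigenvalues x.1 / hρ.eigenvalues x.2
  classical
  -- Interpolating at both families of points avoids having to prove that the ratios `s_k / r_i` are
  -- exactly the spectrum of `Δ`.
  let F : Finset ℝ := Finset.univ.image hH.eigenvalues ∪ Finset.univ.image φ
  let q : Polynomial ℝ := Lagrange.interpolate F id g
  have hq : ∀ x ∈ F, q.eval x = g x := fun x hx =>
    Lagrange.eval_interpolate_at_node g (Function.injective_id.injOn) hx
  have h1 : cfc g M = Polynomial.aeval M q := by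
    rw [← cfc_polynomial q M hH]
    apply cfc_congr
    intro x hx
    rw [hH.spectrum_real_eq_range_eigenvalues] at hx
    obtain ⟨y, rfl⟩ := hx
    exact (hq _ (Finset.mem_union_left _ (Finset.mem_image_of_mem _ (Finset.mem_univ _)))).symm
  have h2 : superFunction g (modularOperator σ ρ) = Polynomial.aeval (modularOperator σ ρ) q := by
    rw [superFunction, ← hM, h1]
    have : Polynomial.aeval M q = LinearMap.toMatrix (Matrix.stdBasis ℂ n n)
        (Matrix.stdBasis ℂ n n) (Polynomial.aeval (modularOperator σ ρ) q) := by
      have := Polynomial.aeval_algHom_apply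
        ((LinearMap.toMatrixAlgEquiv (Matrix.stdBasis ℂ n n)).toAlgHom.restrictScalars ℝ)
        (modularOperator σ ρ) q
      exact this
    rw [this, Matrix.toLin_toMatrix]
  rw [h2, aeval_modularOperator_schurMul]
  congr
  ext k i
  rw [show (if hρ.eigenvalues i = 0 then 0 else hσ.eigenvalues k / hρ.eigenvalues i) = φ (k, i)
    from rfl, hq]
  exact Finset.mem_union_right _ (Finset.mem_image_of_mem _ (Finset.mem_univ _))

end Schur

/-! ### The real Hilbert–Schmidt inner product. -/

section HSInner

variable {n : Type*} [Fintype n] {ρ σ : Matrix n n ℂ}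

/-- The real part of the Hilbert–Schmidt inner product. -/
noncomputable def hsInner (A B : Matrix n n ℂ) : ℝ := (Aᴴ * B).trace.re

lemma hsInner_comm (A B : Matrix n n ℂ) : hsInner A B = hsInner B A := by
  have : (Bᴴ * A) = (Aᴴ * B)ᴴ := by simp
  rw [hsInner, hsInner, this, Matrix.trace_conjTranspose]
  simp

lemma hsInner_add_right (A B C : Matrix n n ℂ) : hsInner A (B + C) = hsInner A B + hsInner A C := by
  simp [hsInner, mul_add]

lemma hsInner_sub_right (A B C : Matrix n n ℂ) : hsInner A (B - C) = hsInner A B - hsInner A C := by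
  simp [hsInner, mul_sub]

lemma hsInner_sub_left (A B C : Matrix n n ℂ) : hsInner (A - B) C = hsInner A C - hsInner B C := by
  simp [hsInner, sub_mul]

lemma hsInner_smul_right (a : ℝ) (A B : Matrix n n ℂ) : hsInner A (a • B) = a * hsInner A B := by
  simp [hsInner]

lemma hsInner_sum_right {ι : Type*} (s : Finset ι) (A : Matrix n n ℂ) (B : ι → Matrix n n ℂ) :
    hsInner A (∑ j ∈ s, B j) = ∑ j ∈ s, hsInner A (B j) := by
  simp [hsInner, Matrix.mul_sum, Matrix.trace_sum]

lemma hsInner_mul_right_comm (hρ : ρ.IsHermitian) (A B : Matrix n n ℂ) :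
    hsInner A (B * ρ) = hsInner B (A * ρ) := by
  rw [hsInner_comm, hsInner, hsInner, Matrix.conjTranspose_mul, hρ.eq, mul_assoc,
    Matrix.trace_mul_comm, mul_assoc]

lemma hsInner_mul_left_comm (hσ : σ.IsHermitian) (A B : Matrix n n ℂ) :
    hsInner A (σ * B) = hsInner B (σ * A) := by
  rw [hsInner_comm, hsInner, hsInner, Matrix.conjTranspose_mul, hσ.eq, mul_assoc]

lemma hsInner_mul_self_nonneg (hσ : σ.PosSemidef) (A : Matrix n n ℂ) : 0 ≤ hsInner A (σ * A) := by
  rw [hsInner, ← mul_assoc]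
  exact (Complex.le_def.mp (hσ.conjTranspose_mul_mul_same A).trace_nonneg).1

end HSInner

/-! ### Powers taken on the support. -/

section Powers

variable {n : Type*} [Fintype n] [DecidableEq n] {ρ σ : Matrix n n ℂ}

lemma psdPow_mul_psdPow (hρ : ρ.PosSemidef) (s t : ℝ) :
    psdPow ρ s * psdPow ρ t = psdPow ρ (s + t) := by
  have hfin : (spectrum ℝ ρ).Finite := Matrix.finite_real_spectrum
  rw [psdPow, psdPow, psdPow, ← cfc_mul _ _ ρ (hfin.continuousOn _) (hfin.continuousOn _)]
  apply cfc_congr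
  intro x hx
  rw [hρ.1.spectrum_real_eq_range_eigenvalues] at hx
  obtain ⟨i, rfl⟩ := hx
  have := hρ.eigenvalues_nonneg i
  simp only
  split_ifs with h
  · simp
  · rw [Real.rpow_add (lt_of_le_of_ne this (Ne.symm h))]

lemma psdPow_one (hρ : ρ.PosSemidef) : psdPow ρ 1 = ρ := by
  have : psdPow ρ 1 = cfc (id : ℝ → ℝ) ρ := by
    rw [psdPow]
    congr 1
    ext x
    split_ifs with h <;> simp [h]
  rw [this, cfc_id ℝ ρ hρ.1.isSelfAdjoint]

lemma psdPow_isHermitian (ρ : Matrix n n ℂ) (s : ℝ) : (psdPow ρ s).IsHermitian :=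
  (cfc_predicate (R := ℝ) (p := IsSelfAdjoint) _ ρ : IsSelfAdjoint (psdPow ρ s))

lemma psdPow_half_mul_self (hρ : ρ.PosSemidef) : psdPow ρ (1 / 2) * psdPow ρ (1 / 2) = ρ := by
  rw [psdPow_mul_psdPow hρ]
  norm_num [psdPow_one hρ]

lemma hsNorm_mul_sqrt_sq (hρ : ρ.PosSemidef) (A : Matrix n n ℂ) :
    hsNorm (A * psdPow ρ (1 / 2)) ^ 2 = hsInner A (A * ρ) := by
  rw [hsNorm_sq, Matrix.conjTranspose_mul, (psdPow_isHermitian _ _).eq, mul_assoc, Matrix.trace_mul_comm,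
    mul_assoc, mul_assoc, psdPow_half_mul_self hρ, hsInner]

end Powers

/-! ### Entropies and resolvents as sums over eigenvalue pairs. -/

section Entropy

variable {n : Type*} [Fintype n] [DecidableEq n] {ρ σ : Matrix n n ℂ}

/-- The sum `∑ rᵢ g(sₖ / rᵢ) |⟨k|K|i⟩|²` over the eigenvalues `rᵢ` of `ρ` and `sₖ` of `σ`. -/
noncomputable def eigSum (hσ : σ.IsHermitian) (hρ : ρ.IsHermitian) (K : Matrix n n ℂ)
    (g : ℝ → ℝ) : ℝ :=
  ∑ k, ∑ i, hρ.eigenvalues i * g (hσ.eigenvalues k / hρ.eigenvalues i) * eigWeight hσ hρ K k i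

lemma eigSum_add (hσ : σ.IsHermitian) (hρ : ρ.IsHermitian) (K : Matrix n n ℂ) (g h : ℝ → ℝ) :
    eigSum hσ hρ K (fun x => g x + h x) = eigSum hσ hρ K g + eigSum hσ hρ K h := by
  simp only [eigSum, ← Finset.sum_add_distrib]
  exact Finset.sum_congr rfl fun k _ => Finset.sum_congr rfl fun i _ => by ring

lemma eigSum_const_mul (hσ : σ.IsHermitian) (hρ : ρ.IsHermitian) (K : Matrix n n ℂ) (a : ℝ)
    (g : ℝ → ℝ) : eigSum hσ hρ K (fun x => a * g x) = a * eigSum hσ hρ K g := by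
  simp only [eigSum, Finset.mul_sum]
  exact Finset.sum_congr rfl fun k _ => Finset.sum_congr rfl fun i _ => by ring

lemma psdPow_half_aux {r : ℝ} (hr : 0 ≤ r) :
    (if r = 0 then 0 else r ^ (1 / 2 : ℝ)) * (if r = 0 then 0 else r ^ (1 / 2 : ℝ)) = r := by
  split_ifs with h
  · simp [h]
  · rw [← Real.sqrt_eq_rpow, Real.mul_self_sqrt hr]

open Classical in
lemma quasiRelEntropy_eq (hσ : σ.PosSemidef) (hρ : ρ.PosSemidef) (K : Matrix n n ℂ) (f : ℝ → ℝ) :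
    quasiRelEntropy f K ρ σ =
      if (∃ l : ℝ, Tendsto f (𝓝[>] (0 : ℝ)) (𝓝 l)) ∨ psdPow σ 0 * K * ρ = K * ρ then
        ((eigSum hσ.1 hρ.1 K (extendZero f) : ℝ) : EReal) else ⊤ := by
  rw [quasiRelEntropy]
  congr 2
  have h1 : psdPow ρ (1 / 2) * Kᴴ = (K * psdPow ρ (1 / 2))ᴴ := by
    rw [Matrix.conjTranspose_mul, (psdPow_isHermitian _ _).eq]
  rw [h1, psdPow, mul_cfc_eq_schurMul hσ.1 hρ.1, superFunction_modularOperator_schurMul,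
    trace_schurMul_conjTranspose_mul, eigSum]
  refine Finset.sum_congr rfl fun k _ => Finset.sum_congr rfl fun i _ => ?_
  have := psdPow_half_aux (hρ.eigenvalues_nonneg i)
  by_cases h : hρ.1.eigenvalues i = 0
  · simp [h]
  · simp only [h, if_false] at this ⊢
    rw [mul_left_comm, this]
    ring

/-- The support condition says that `σ⁰ K ρ - K ρ` has norm zero; its square norm is a sum of
nonnegative terms, one of which is `r_i²` times this weight. -/
lemma eigWeight_eq_zero_of_support (hσ : σ.PosSemidef) (hρ : ρ.PosSemidef) (K : Matrix n n ℂ)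
    (h : psdPow σ 0 * K * ρ = K * ρ) {k i : n} (hk : hσ.1.eigenvalues k = 0)
    (hi : hρ.1.eigenvalues i ≠ 0) : eigWeight hσ.1 hρ.1 K k i = 0 := by
  have h0 : hsNorm (schurMul hσ.1 hρ.1 K (fun k i =>
      (if hσ.1.eigenvalues k = 0 then 0 else hσ.1.eigenvalues k ^ (0 : ℝ)) * hρ.1.eigenvalues i
        - hρ.1.eigenvalues i)) ^ 2 = 0 := by
    rw [← schurMul_sub, ← cfc_mul_schurMul hσ.1 hρ.1 K
      (fun x : ℝ => if x = 0 then 0 else x ^ (0 : ℝ)), ← mul_eq_schurMul]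
    rw [mul_assoc, psdPow] at h
    rw [h]
    simp [hsNorm]
  rw [hsNorm_schurMul_sq] at h0
  have h1 := (Finset.sum_eq_zero_iff_of_nonneg (fun k _ => Finset.sum_nonneg fun i _ =>
    mul_nonneg (sq_nonneg _) (eigWeight_nonneg hσ.1 hρ.1 K k i))).mp h0 k (Finset.mem_univ _)
  have h2 := (Finset.sum_eq_zero_iff_of_nonneg (fun i _ =>
    mul_nonneg (sq_nonneg _) (eigWeight_nonneg hσ.1 hρ.1 K k i))).mp h1 i (Finset.mem_univ _)
  simpa [hk, hi] using h2

/-- A finite quasi-relative entropy is the limit of those of the shifted functions `f(· + ε)`. -/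
lemma tendsto_eigSum_shift (hσ : σ.PosSemidef) (hρ : ρ.PosSemidef) (K : Matrix n n ℂ) {f : ℝ → ℝ}
    (hf : ∀ x, 0 < x → Tendsto (fun ε => f (x + ε)) (𝓝[>] 0) (𝓝 (f x)))
    (hfin : quasiRelEntropy f K ρ σ ≠ ⊤) :
    Tendsto (fun ε => eigSum hσ.1 hρ.1 K (fun x => f (x + ε))) (𝓝[>] 0)
      (𝓝 (quasiRelEntropy f K ρ σ).toReal) := by
  rw [quasiRelEntropy_eq hσ hρ] at hfin ⊢
  split_ifs at hfin ⊢ with hcond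
  swap
  · exact absurd rfl hfin
  rw [EReal.toReal_coe]
  refine tendsto_finsetSum _ fun k _ => tendsto_finsetSum _ fun i _ => ?_
  rcases (hρ.eigenvalues_nonneg i).eq_or_lt' with hi | hi
  · simp [hi]
  rcases (hσ.eigenvalues_nonneg k).eq_or_lt' with hk | hk
  · by_cases hw : eigWeight hσ.1 hρ.1 K k i = 0
    · simp [hw]
    -- A nonzero weight at `s_k = 0 < r_i` violates the support condition, so finiteness leaves only
    -- a finite limit of `f` at `0`.
    obtain ⟨l, hl⟩ := hcond.resolve_right
      fun h => hw (eigWeight_eq_zero_of_support hσ hρ K h hk hi.ne')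
    simp only [hk, zero_div, zero_add, extendZero, lt_irrefl, if_false]
    rw [hl.limUnder_eq]
    exact (hl.const_mul _).mul_const _
  · have hx := div_pos hk hi
    simp only [extendZero, hx, if_true]
    exact ((hf _ hx).const_mul _).mul_const _

/-- `(t R_ρ + L_σ)⁻¹ (K ρ)`, that is, `(t + Δ_{σ,ρ})⁻¹ K` on the support of `ρ`. -/
noncomputable def resolventMul (hσ : σ.IsHermitian) (hρ : ρ.IsHermitian) (K : Matrix n n ℂ)
    (t : ℝ) : Matrix n n ℂ :=
  schurMul hσ hρ K (fun k i => hρ.eigenvalues i / (t * hρ.eigenvalues i + hσ.eigenvalues k))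

/-- This equation is linear in the pair `(ρ, σ)`, unlike the resolvent itself, which is what lets
mixtures be compared with their components. -/
lemma resolventMul_equation (hσ : σ.PosSemidef) (hρ : ρ.PosSemidef) (K : Matrix n n ℂ) {t : ℝ}
    (ht : 0 < t) :
    t • (resolventMul hσ.1 hρ.1 K t * ρ) + σ * resolventMul hσ.1 hρ.1 K t = K * ρ := by
  rw [resolventMul, schurMul_mul, mul_schurMul, schurMul_smul, schurMul_add,
    mul_eq_schurMul hσ.1 hρ.1]
  congr
  ext k i
  have hk := hσ.eigenvalues_nonneg k
  rcases (hρ.eigenvalues_nonneg i).eq_or_lt' with hi | hi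
  · simp [hi]
  · have : t * hρ.1.eigenvalues i + hσ.1.eigenvalues k ≠ 0 := by positivity
    field_simp

lemma eigSum_inv_add (hσ : σ.PosSemidef) (hρ : ρ.PosSemidef) (K : Matrix n n ℂ) {t : ℝ}
    (ht : 0 < t) :
    eigSum hσ.1 hρ.1 K (fun x => 1 / (t + x)) =
      hsInner (resolventMul hσ.1 hρ.1 K t) (K * ρ) := by
  rw [resolventMul, mul_eq_schurMul hσ.1 hρ.1, hsInner, trace_schurMul_conjTranspose_mul, eigSum]
  refine Finset.sum_congr rfl fun k _ => Finset.sum_congr rfl fun i _ => ?_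
  have hk := hσ.eigenvalues_nonneg k
  rcases (hρ.eigenvalues_nonneg i).eq_or_lt' with hi | hi
  · simp [hi]
  · have : t * hρ.1.eigenvalues i + hσ.1.eigenvalues k ≠ 0 := by positivity
    field_simp

lemma eigSum_one (hσ : σ.PosSemidef) (hρ : ρ.PosSemidef) (K : Matrix n n ℂ) :
    eigSum hσ.1 hρ.1 K (fun _ => 1) = hsInner K (K * ρ) := by
  rw [← hsNorm_mul_sqrt_sq hρ, psdPow, mul_cfc_eq_schurMul hσ.1 hρ.1, hsNorm_schurMul_sq, eigSum]
  refine Finset.sum_congr rfl fun k _ => Finset.sum_congr rfl fun i _ => ?_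
  rw [sq, psdPow_half_aux (hρ.eigenvalues_nonneg i), mul_one]

end Entropy

/-! ### The convexity defect and its lower bound for resolvent functions. -/

section Gap

variable {ι n : Type*} [Fintype ι] [Fintype n] [DecidableEq n] {p : ι → ℝ}
  {ρs σs : ι → Matrix n n ℂ} {ρ σ : Matrix n n ℂ}

/-- The defect of joint convexity of the entropy sum with function `g`. -/
noncomputable def convexityGap (p : ι → ℝ) (hσs : ∀ j, (σs j).IsHermitian)
    (hρs : ∀ j, (ρs j).IsHermitian) (hσ : σ.IsHermitian) (hρ : ρ.IsHermitian) (K : Matrix n n ℂ)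
    (g : ℝ → ℝ) : ℝ :=
  ∑ j, p j * eigSum (hσs j) (hρs j) K g - eigSum hσ hρ K g

lemma convexityGap_add (hσs : ∀ j, (σs j).IsHermitian)
    (hρs : ∀ j, (ρs j).IsHermitian) (hσ : σ.IsHermitian) (hρ : ρ.IsHermitian) (K : Matrix n n ℂ)
    (g h : ℝ → ℝ) : convexityGap p hσs hρs hσ hρ K (fun x => g x + h x) =
      convexityGap p hσs hρs hσ hρ K g + convexityGap p hσs hρs hσ hρ K h := by
  simp only [convexityGap, eigSum_add, mul_add, Finset.sum_add_distrib]
  ring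

lemma convexityGap_const_mul (hσs : ∀ j, (σs j).IsHermitian)
    (hρs : ∀ j, (ρs j).IsHermitian) (hσ : σ.IsHermitian) (hρ : ρ.IsHermitian) (K : Matrix n n ℂ)
    (a : ℝ) (g : ℝ → ℝ) : convexityGap p hσs hρs hσ hρ K (fun x => a * g x) =
      a * convexityGap p hσs hρs hσ hρ K g := by
  simp only [convexityGap, eigSum_const_mul, mul_sub, Finset.mul_sum]
  congr 1
  exact Finset.sum_congr rfl fun j _ => by ring

variable (hσs : ∀ j, (σs j).PosSemidef) (hρs : ∀ j, (ρs j).PosSemidef) (hσ : σ.PosSemidef)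
  (hρ : ρ.PosSemidef) (K : Matrix n n ℂ)

lemma convexityGap_one (hρsum : ρ = ∑ j, p j • ρs j) :
    convexityGap p (fun j => (hσs j).1) (fun j => (hρs j).1) hσ.1 hρ.1 K (fun _ => 1) = 0 := by
  simp only [convexityGap, eigSum_one, hσs, hρs, hσ, hρ]
  rw [hρsum, Matrix.mul_sum, hsInner_sum_right, sub_eq_zero]
  simp [hsInner_smul_right]

lemma convexityGap_const (hρsum : ρ = ∑ j, p j • ρs j) (a : ℝ) :
    convexityGap p (fun j => (hσs j).1) (fun j => (hρs j).1) hσ.1 hρ.1 K (fun _ => a) = 0 := by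
  have := convexityGap_const_mul (p := p) (fun j => (hσs j).1) (fun j => (hρs j).1) hσ.1 hρ.1 K a
    (fun _ => 1)
  rw [convexityGap_one hσs hρs hσ hρ K hρsum, mul_zero] at this
  simpa using this

/-- The solution `Y` for the mixture serves as a trial operator in each component's problem.
Completing the square there costs the quadratic form of `Y - Z j`, and the terms in `Y` alone add up
to those of the mixture by linearity in `(ρ, σ)`. -/
lemma le_convexityGap_inv_add (hp : ∀ j, 0 ≤ p j) (hρsum : ρ = ∑ j, p j • ρs j)
    (hσsum : σ = ∑ j, p j • σs j) {t : ℝ} (ht : 0 < t) :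
    t * ∑ j, p j * hsNorm ((resolventMul hσ.1 hρ.1 K t -
        resolventMul (hσs j).1 (hρs j).1 K t) * psdPow (ρs j) (1 / 2)) ^ 2 ≤
      convexityGap p (fun j => (hσs j).1) (fun j => (hρs j).1) hσ.1 hρ.1 K
        (fun x => 1 / (t + x)) := by
  have hY := resolventMul_equation hσ hρ K ht
  have hYs := fun j => resolventMul_equation (hσs j) (hρs j) K ht
  simp only [convexityGap, eigSum_inv_add, hσ, hρ, hσs, hρs, ht]
  set Y := resolventMul hσ.1 hρ.1 K t
  set Z : ι → Matrix n n ℂ := fun j => resolventMul (hσs j).1 (hρs j).1 K t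
  have hj : ∀ j, t * hsNorm ((Y - Z j) * psdPow (ρs j) (1 / 2)) ^ 2 ≤
      hsInner Y (t • (Y * ρs j) + σs j * Y) - 2 * hsInner Y (K * ρs j)
        + hsInner (Z j) (K * ρs j) := by
    intro j
    rw [hsNorm_mul_sqrt_sq (hρs j)]
    -- The only loss in the estimate: the `σs j` part of the quadratic form is discarded.
    have h1 := hsInner_mul_self_nonneg (hσs j) (Y - Z j)
    have h2 := hYs j
    have e1 : hsInner Y (K * ρs j) = t * hsInner Y (Z j * ρs j) + hsInner Y (σs j * Z j) := by
      rw [← hYs j, hsInner_add_right, hsInner_smul_right]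
    have e2 : hsInner (Z j) (K * ρs j) =
        t * hsInner (Z j) (Z j * ρs j) + hsInner (Z j) (σs j * Z j) := by
      rw [← hYs j, hsInner_add_right, hsInner_smul_right]
    have e3 := hsInner_mul_right_comm (hρs j).1 Y (Z j)
    have e4 := hsInner_mul_left_comm (hσs j).1 Y (Z j)
    rw [hsInner_add_right, hsInner_smul_right, e1, e2]
    rw [mul_sub, hsInner_sub_left, hsInner_sub_right, hsInner_sub_right] at h1
    rw [sub_mul, hsInner_sub_left, hsInner_sub_right, hsInner_sub_right, ← e3]
    linarith
  have hsum : ∑ j, p j * hsInner Y (t • (Y * ρs j) + σs j * Y) = hsInner Y (K * ρ) := by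
    rw [← hY]
    conv_rhs => rw [hρsum, hσsum]
    rw [hsInner_add_right, hsInner_smul_right, Matrix.mul_sum, Matrix.sum_mul, hsInner_sum_right,
      hsInner_sum_right, Finset.mul_sum, ← Finset.sum_add_distrib]
    refine Finset.sum_congr rfl fun j _ => ?_
    rw [hsInner_add_right, hsInner_smul_right, mul_smul_comm, smul_mul_assoc, hsInner_smul_right,
      hsInner_smul_right]
    ring
  have hsum2 : ∑ j, p j * hsInner Y (K * ρs j) = hsInner Y (K * ρ) := by
    conv_rhs => rw [hρsum]
    rw [Matrix.mul_sum, hsInner_sum_right]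
    refine Finset.sum_congr rfl fun j _ => ?_
    rw [mul_smul_comm, hsInner_smul_right]
  calc _ = ∑ j, p j * (t * hsNorm ((Y - Z j) * psdPow (ρs j) (1 / 2)) ^ 2) := by
        rw [Finset.mul_sum]; exact Finset.sum_congr rfl fun j _ => by ring
    _ ≤ ∑ j, p j * (hsInner Y (t • (Y * ρs j) + σs j * Y) - 2 * hsInner Y (K * ρs j)
        + hsInner (Z j) (K * ρs j)) :=
        Finset.sum_le_sum fun j _ => mul_le_mul_of_nonneg_left (hj j) (hp j)
    _ = ∑ j, p j * hsInner Y (t • (Y * ρs j) + σs j * Y) - 2 * ∑ j, p j * hsInner Y (K * ρs j)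
        + ∑ j, p j * hsInner (Z j) (K * ρs j) := by
        rw [Finset.mul_sum, ← Finset.sum_sub_distrib, ← Finset.sum_add_distrib]
        exact Finset.sum_congr rfl fun j _ => by ring
    _ = _ := by rw [hsum, hsum2]; ring

lemma convexityGap_inv_add_nonneg (hp : ∀ j, 0 ≤ p j) (hρsum : ρ = ∑ j, p j • ρs j)
    (hσsum : σ = ∑ j, p j • σs j) {t : ℝ} (ht : 0 < t) :
    0 ≤ convexityGap p (fun j => (hσs j).1) (fun j => (hρs j).1) hσ.1 hρ.1 K
        (fun x => 1 / (t + x)) :=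
  le_trans (mul_nonneg ht.le (Finset.sum_nonneg fun j _ => mul_nonneg (hp j) (sq_nonneg _)))
    (le_convexityGap_inv_add hσs hρs hσ hρ K hp hρsum hσsum ht)

lemma tendsto_convexityGap {α : Type*} {l : Filter α} {g : α → ℝ → ℝ} {g₀ : ℝ → ℝ}
    (hg : ∀ x, 0 ≤ x → Tendsto (fun a => g a x) l (𝓝 (g₀ x))) :
    Tendsto (fun a => convexityGap p (fun j => (hσs j).1) (fun j => (hρs j).1) hσ.1 hρ.1 K (g a))
      l (𝓝 (convexityGap p (fun j => (hσs j).1) (fun j => (hρs j).1) hσ.1 hρ.1 K g₀)) := by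
  have key : ∀ {σ ρ : Matrix n n ℂ} (hσ : σ.PosSemidef) (hρ : ρ.PosSemidef),
      Tendsto (fun a => eigSum hσ.1 hρ.1 K (g a)) l (𝓝 (eigSum hσ.1 hρ.1 K g₀)) :=
    fun hσ hρ => tendsto_finsetSum _ fun k _ => tendsto_finsetSum _ fun i _ =>
      ((hg _ (div_nonneg (hσ.eigenvalues_nonneg k) (hρ.eigenvalues_nonneg i))).const_mul _).mul_const
        _
  exact (tendsto_finsetSum _ fun j _ => (key (hσs j) (hρs j)).const_mul _).sub (key hσ hρ)

/-- Since `t² / (t + x) - t → -x` as `t → ∞` and constants have no defect, the function `-x`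
inherits a nonnegative defect from the resolvent functions. -/
lemma convexityGap_id_nonpos (hp : ∀ j, 0 ≤ p j) (hρsum : ρ = ∑ j, p j • ρs j)
    (hσsum : σ = ∑ j, p j • σs j) :
    convexityGap p (fun j => (hσs j).1) (fun j => (hρs j).1) hσ.1 hρ.1 K (fun x => x) ≤ 0 := by
  have hlim : ∀ x : ℝ, 0 ≤ x →
      Tendsto (fun t : ℝ => t ^ 2 * (1 / (t + x)) + -t) atTop (𝓝 (-1 * x)) := by
    intro x hx
    have h1 : Tendsto (fun t : ℝ => -x + x ^ 2 * (t + x)⁻¹) atTop (𝓝 (-x + x ^ 2 * 0)) :=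
      ((tendsto_inv_atTop_zero.comp (tendsto_atTop_add_const_right _ x tendsto_id)).const_mul
        _).const_add _
    rw [mul_zero, add_zero, ← neg_one_mul] at h1
    refine h1.congr' ?_
    filter_upwards [eventually_gt_atTop 0] with t ht
    have : t + x ≠ 0 := by positivity
    field_simp
    ring
  have h := tendsto_convexityGap (p := p) hσs hρs hσ hρ K hlim
  rw [convexityGap_const_mul] at h
  have h2 := ge_of_tendsto h (b := 0) (by
    filter_upwards [eventually_gt_atTop 0] with t ht
    rw [convexityGap_add, convexityGap_const_mul, convexityGap_const hσs hρs hσ hρ K hρsum,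
      add_zero]
    exact mul_nonneg (sq_nonneg t)
      (convexityGap_inv_add_nonneg hσs hρs hσ hρ K hp hρsum hσsum ht))
  linarith

end Gap

/-! ### The canonical measure of a regular function. -/

section CanonicalMeasure

/-- Löwner's theorem is not needed: without a representing measure the default value `0` would have
to dominate Lebesgue measure on the nondegenerate interval belonging to `T = 2`. -/
lemma IsRegularFunction.isCanonicalMeasure {f : ℝ → ℝ} {β : ℝ} (hβ0 : 0 < β) (hβ1 : β < 1)
    (hf : IsRegularFunction f β) : IsCanonicalMeasure f (canonicalMeasure f) := by
  classical
  by_cases h : ∃ μ, IsCanonicalMeasure f μ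
  · rw [canonicalMeasure, dif_pos h]
    exact h.choose_spec
  exfalso
  have hL : 1 < cutL β 2 := by
    rw [cutL]
    split_ifs
    · norm_num
    · exact Real.one_lt_rpow (by norm_num) (div_pos (by linarith) hβ0)
  have hR : 1 < cutR β 2 := by
    rw [cutR]
    split_ifs
    · exact Real.one_lt_rpow (by norm_num) (div_pos hβ0 (by linarith))
    · norm_num
  obtain ⟨c, hc, hc'⟩ := sInf_lt_iff.mp (hf.2 2 (by norm_num))
  simp only [Set.mem_ofPred_eq] at hc
  have hle := hc Set.univ
  simp only [canonicalMeasure, dif_neg h, Measure.restrict_zero, smul_zero, Measure.coe_zero,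
    Pi.zero_apply, Measure.restrict_apply_univ, Real.volume_Icc, nonpos_iff_eq_zero,
    ENNReal.ofReal_eq_zero] at hle
  have := inv_lt_one_of_one_lt₀ hL
  linarith

lemma volume_restrict_le_of_regularityConst_lt {f : ℝ → ℝ} {β T : ℝ} {c : ℝ≥0∞}
    (h : regularityConst f β T < c) :
    (volume : Measure ℝ).restrict (Set.Icc (cutL β T)⁻¹ (cutR β T)) ≤
      c • (canonicalMeasure f).restrict (Set.Icc (cutL β T)⁻¹ (cutR β T)) := by
  obtain ⟨c', hc', hlt⟩ := sInf_lt_iff.mp h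
  refine le_trans hc' fun s => ?_
  simp only [Measure.smul_apply, smul_eq_mul]
  gcongr

variable {f : ℝ → ℝ} {μ : Measure ℝ}

lemma IsCanonicalMeasure.ae_nonneg (h : IsCanonicalMeasure f μ) : ∀ᵐ t ∂μ, 0 ≤ t := by
  rw [ae_iff]
  simpa [Set.Iio] using h.1

lemma IsCanonicalMeasure.integrable_inv (h : IsCanonicalMeasure f μ) :
    Integrable (fun t : ℝ => 1 / (t ^ 2 + 1)) μ := by
  refine ⟨Measurable.aestronglyMeasurable (by fun_prop), ?_⟩
  rw [hasFiniteIntegral_iff_ofReal (ae_of_all _ fun t => by positivity)]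
  exact h.2.1

/-- The subtraction of `t / (t² + 1)` yields a factor `1 / (t² + 1)`, which is `μ`-integrable; the
bound gives integrability of the kernel and a dominating function for limits in `x`. -/
lemma abs_inv_add_sub_le {t x : ℝ} (ht : 0 ≤ t) (hx : 0 < x) :
    |1 / (t + x) - t / (t ^ 2 + 1)| ≤ (x + 1 / x) * (1 / (t ^ 2 + 1)) := by
  have h1 : 1 / (t + x) - t / (t ^ 2 + 1) = (1 - t * x) / (t + x) * (1 / (t ^ 2 + 1)) := by
    have : t + x ≠ 0 := by positivity
    field_simp
    ring
  rw [h1, abs_mul, abs_of_nonneg (by positivity : (0 : ℝ) ≤ 1 / (t ^ 2 + 1))]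
  gcongr
  rw [abs_div, abs_of_pos (by positivity : 0 < t + x), div_le_iff₀ (by positivity)]
  have h2 : |1 - t * x| ≤ 1 + t * x := by
    rw [abs_le]
    constructor <;> nlinarith [mul_nonneg ht hx.le]
  refine h2.trans ?_
  have h3 : (x + 1 / x) * (t + x) = 1 + t * x + x ^ 2 + t / x := by
    field_simp
    ring
  rw [h3]
  have : 0 ≤ t / x := by positivity
  nlinarith [sq_nonneg x]

lemma IsCanonicalMeasure.integrable_kernel (h : IsCanonicalMeasure f μ) {x : ℝ} (hx : 0 < x) :
    Integrable (fun t : ℝ => 1 / (t + x) - t / (t ^ 2 + 1)) μ := by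
  refine (h.integrable_inv.const_mul (x + 1 / x)).mono' (by fun_prop) ?_
  filter_upwards [h.ae_nonneg] with t ht
  exact abs_inv_add_sub_le ht hx

lemma IsCanonicalMeasure.tendsto_shift (h : IsCanonicalMeasure f μ) {x : ℝ} (hx : 0 < x) :
    Tendsto (fun ε => f (x + ε)) (𝓝[>] 0) (𝓝 (f x)) := by
  obtain ⟨a, b, -, hrep⟩ := h.2.2
  have hev : ∀ᶠ ε : ℝ in 𝓝[>] 0, 0 < ε ∧ ε < 1 := by
    filter_upwards [Ioo_mem_nhdsGT (zero_lt_one' ℝ)] with ε hε using hε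
  have h1 : Tendsto (fun ε => ∫ t, (1 / (t + (x + ε)) - t / (t ^ 2 + 1)) ∂μ) (𝓝[>] 0)
      (𝓝 (∫ t, (1 / (t + x) - t / (t ^ 2 + 1)) ∂μ)) := by
    refine tendsto_integral_filter_of_dominated_convergence
      (fun t => (x + 1 + 1 / x) * (1 / (t ^ 2 + 1))) (Eventually.of_forall fun ε => by fun_prop) ?_
      (h.integrable_inv.const_mul _) ?_
    · filter_upwards [hev] with ε hε
      filter_upwards [h.ae_nonneg] with t ht
      refine (abs_inv_add_sub_le ht (by linarith : 0 < x + ε)).trans ?_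
      gcongr
      · exact hε.2.le
      · linarith
    · filter_upwards [h.ae_nonneg] with t ht
      refine Tendsto.sub_const (Tendsto.div tendsto_const_nhds ?_ (by positivity : t + x ≠ 0)) _
      have : Tendsto (fun ε : ℝ => t + (x + ε)) (𝓝 0) (𝓝 (t + (x + 0))) :=
        Continuous.tendsto (by fun_prop) 0
      rw [add_zero] at this
      exact this.mono_left nhdsWithin_le_nhds
  have h2 : Tendsto (fun ε => a * (x + ε) + b) (𝓝[>] 0) (𝓝 (a * x + b)) := by
    have : Tendsto (fun ε : ℝ => a * (x + ε) + b) (𝓝 0) (𝓝 (a * (x + 0) + b)) :=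
      Continuous.tendsto (by fun_prop) 0
    rw [add_zero] at this
    exact this.mono_left nhdsWithin_le_nhds
  rw [hrep x hx]
  refine (h2.add h1).congr' ?_
  filter_upwards [hev] with ε hε
  rw [hrep _ (by linarith)]

end CanonicalMeasure

/-! ### The defect of `f` as an integral of resolvent defects. -/

section GapIntegral

variable {ι n : Type*} [Fintype ι] [Fintype n] [DecidableEq n] {p : ι → ℝ}
  {ρs σs : ι → Matrix n n ℂ} {ρ σ : Matrix n n ℂ}

lemma eigSum_congr (hσ : σ.PosSemidef) (hρ : ρ.PosSemidef) (K : Matrix n n ℂ) {g h : ℝ → ℝ}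
    (H : ∀ x, 0 ≤ x → g x = h x) : eigSum hσ.1 hρ.1 K g = eigSum hσ.1 hρ.1 K h :=
  Finset.sum_congr rfl fun k _ => Finset.sum_congr rfl fun i _ => by
    rw [H _ (div_nonneg (hσ.eigenvalues_nonneg k) (hρ.eigenvalues_nonneg i))]

lemma abs_eigSum_le (hσ : σ.PosSemidef) (hρ : ρ.PosSemidef) (K : Matrix n n ℂ) {g : ℝ → ℝ} {B : ℝ}
    (H : ∀ x, 0 ≤ x → |g x| ≤ B) :
    |eigSum hσ.1 hρ.1 K g| ≤ eigSum hσ.1 hρ.1 K (fun _ => 1) * B := by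
  rw [mul_comm, ← eigSum_const_mul]
  refine (Finset.abs_sum_le_sum_abs _ _).trans (Finset.sum_le_sum fun k _ => ?_)
  refine (Finset.abs_sum_le_sum_abs _ _).trans (Finset.sum_le_sum fun i _ => ?_)
  have h1 := hρ.eigenvalues_nonneg i
  have h2 := eigWeight_nonneg hσ.1 hρ.1 K k i
  rw [abs_mul, abs_mul, abs_of_nonneg h1, abs_of_nonneg h2, mul_one]
  gcongr
  exact H _ (div_nonneg (hσ.eigenvalues_nonneg k) h1)

lemma integrable_eigSum (hσ : σ.PosSemidef) (hρ : ρ.PosSemidef) (K : Matrix n n ℂ)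
    {μ : Measure ℝ} {G : ℝ → ℝ → ℝ} (hG : ∀ x, 0 ≤ x → Integrable (fun t => G t x) μ) :
    Integrable (fun t => eigSum hσ.1 hρ.1 K (G t)) μ :=
  integrable_finsetSum _ fun k _ => integrable_finsetSum _ fun i _ =>
    ((hG _ (div_nonneg (hσ.eigenvalues_nonneg k) (hρ.eigenvalues_nonneg i))).const_mul _).mul_const _

lemma eigSum_integral (hσ : σ.PosSemidef) (hρ : ρ.PosSemidef) (K : Matrix n n ℂ)
    {μ : Measure ℝ} {G : ℝ → ℝ → ℝ} (hG : ∀ x, 0 ≤ x → Integrable (fun t => G t x) μ) :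
    eigSum hσ.1 hρ.1 K (fun x => ∫ t, G t x ∂μ) = ∫ t, eigSum hσ.1 hρ.1 K (G t) ∂μ := by
  have hx := fun k i => div_nonneg (hσ.eigenvalues_nonneg k) (hρ.eigenvalues_nonneg i)
  simp only [eigSum]
  rw [integral_finsetSum _ fun k _ => integrable_finsetSum _ fun i _ =>
    ((hG _ (hx k i)).const_mul _).mul_const _]
  refine Finset.sum_congr rfl fun k _ => ?_
  rw [integral_finsetSum _ fun i _ => ((hG _ (hx k i)).const_mul _).mul_const _]
  refine Finset.sum_congr rfl fun i _ => ?_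
  rw [integral_mul_const, integral_const_mul]

variable (hσs : ∀ j, (σs j).PosSemidef) (hρs : ∀ j, (ρs j).PosSemidef) (hσ : σ.PosSemidef)
  (hρ : ρ.PosSemidef) (K : Matrix n n ℂ)

lemma convexityGap_congr {g h : ℝ → ℝ} (H : ∀ x, 0 ≤ x → g x = h x) :
    convexityGap p (fun j => (hσs j).1) (fun j => (hρs j).1) hσ.1 hρ.1 K g =
      convexityGap p (fun j => (hσs j).1) (fun j => (hρs j).1) hσ.1 hρ.1 K h := by
  rw [convexityGap, convexityGap, eigSum_congr hσ hρ K H]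
  congr 1
  exact Finset.sum_congr rfl fun j _ => by rw [eigSum_congr (hσs j) (hρs j) K H]

lemma exists_abs_convexityGap_le : ∃ M : ℝ, ∀ (g : ℝ → ℝ) (B : ℝ), (∀ x, 0 ≤ x → |g x| ≤ B) →
    |convexityGap p (fun j => (hσs j).1) (fun j => (hρs j).1) hσ.1 hρ.1 K g| ≤ M * B := by
  refine ⟨∑ j, |p j| * eigSum (hσs j).1 (hρs j).1 K (fun _ => 1) +
    eigSum hσ.1 hρ.1 K (fun _ => 1), fun g B H => ?_⟩
  rw [convexityGap, add_mul, Finset.sum_mul]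
  refine (abs_sub _ _).trans (add_le_add ?_ (abs_eigSum_le hσ hρ K H))
  refine (Finset.abs_sum_le_sum_abs _ _).trans (Finset.sum_le_sum fun j _ => ?_)
  rw [abs_mul, mul_assoc]
  gcongr
  exact abs_eigSum_le (hσs j) (hρs j) K H

lemma integrable_convexityGap {μ : Measure ℝ} {G : ℝ → ℝ → ℝ}
    (hG : ∀ x, 0 ≤ x → Integrable (fun t => G t x) μ) :
    Integrable (fun t => convexityGap p (fun j => (hσs j).1) (fun j => (hρs j).1) hσ.1 hρ.1 K
      (G t)) μ :=
  (integrable_finsetSum _ fun j _ => (integrable_eigSum (hσs j) (hρs j) K hG).const_mul _).sub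
    (integrable_eigSum hσ hρ K hG)

lemma convexityGap_integral {μ : Measure ℝ} {G : ℝ → ℝ → ℝ}
    (hG : ∀ x, 0 ≤ x → Integrable (fun t => G t x) μ) :
    convexityGap p (fun j => (hσs j).1) (fun j => (hρs j).1) hσ.1 hρ.1 K
      (fun x => ∫ t, G t x ∂μ) =
    ∫ t, convexityGap p (fun j => (hσs j).1) (fun j => (hρs j).1) hσ.1 hρ.1 K (G t) ∂μ := by
  simp only [convexityGap]
  have hj := fun j => integrable_eigSum (hσs j) (hρs j) K hG
  rw [integral_sub (integrable_finsetSum _ fun j _ => (hj j).const_mul _)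
    (integrable_eigSum hσ hρ K hG), integral_finsetSum _ fun j _ => (hj j).const_mul _,
    eigSum_integral hσ hρ K hG]
  congr 1
  refine Finset.sum_congr rfl fun j _ => ?_
  rw [integral_const_mul, eigSum_integral (hσs j) (hρs j) K hG]

variable {f : ℝ → ℝ} {μ : Measure ℝ}

/-- The kernel `1 / (t + ε + x)` alone need not be `μ`-integrable. Its compensated version is, and
the compensating term is constant in `x`, hence invisible to the defect. -/
lemma integrable_convexityGap_shift (h : IsCanonicalMeasure f μ) (hρsum : ρ = ∑ j, p j • ρs j)
    {ε : ℝ} (hε : 0 < ε) :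
    Integrable (fun t => convexityGap p (fun j => (hσs j).1) (fun j => (hρs j).1) hσ.1 hρ.1 K
      (fun x => 1 / (t + ε + x))) μ := by
  have := integrable_convexityGap (p := p) hσs hρs hσ hρ K
    (G := fun t x => 1 / (t + ε + x) + -(t / (t ^ 2 + 1))) (μ := μ) fun x hx => by
      simpa only [add_assoc, ← sub_eq_add_neg] using
        h.integrable_kernel (by linarith : 0 < ε + x)
  simpa only [convexityGap_add, convexityGap_const hσs hρs hσ hρ K hρsum, add_zero] using this

lemma convexityGap_shift_eq (h : IsCanonicalMeasure f μ) (hρsum : ρ = ∑ j, p j • ρs j) :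
    ∃ a ≤ 0, ∀ ε : ℝ, 0 < ε →
      convexityGap p (fun j => (hσs j).1) (fun j => (hρs j).1) hσ.1 hρ.1 K (fun x => f (x + ε)) =
      a * convexityGap p (fun j => (hσs j).1) (fun j => (hρs j).1) hσ.1 hρ.1 K (fun x => x) +
      ∫ t, convexityGap p (fun j => (hσs j).1) (fun j => (hρs j).1) hσ.1 hρ.1 K
        (fun x => 1 / (t + ε + x)) ∂μ := by
  obtain ⟨a, b, ha, hrep⟩ := h.2.2
  refine ⟨a, ha, fun ε hε => ?_⟩
  have hG : ∀ x, 0 ≤ x → Integrable (fun t => 1 / (t + ε + x) + -(t / (t ^ 2 + 1))) μ := by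
    intro x hx
    simpa only [add_assoc, ← sub_eq_add_neg] using h.integrable_kernel (by linarith : 0 < ε + x)
  have h1 : ∀ x, 0 ≤ x → f (x + ε) = a * x + (a * ε + b) +
      ∫ t, (1 / (t + ε + x) + -(t / (t ^ 2 + 1))) ∂μ := by
    intro x hx
    rw [hrep _ (by linarith)]
    simp only [add_assoc, ← sub_eq_add_neg, add_comm x ε]
    ring
  rw [convexityGap_congr hσs hρs hσ hρ K h1, convexityGap_add, convexityGap_add,
    convexityGap_const hσs hρs hσ hρ K hρsum, add_zero, convexityGap_const_mul,
    convexityGap_integral hσs hρs hσ hρ K hG]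
  simp only [convexityGap_add, convexityGap_const hσs hρs hσ hρ K hρsum, add_zero]

lemma convexityGap_shift_nonneg (h : IsCanonicalMeasure f μ) (hp : ∀ j, 0 ≤ p j)
    (hρsum : ρ = ∑ j, p j • ρs j) (hσsum : σ = ∑ j, p j • σs j) {ε : ℝ} (hε : 0 < ε) :
    0 ≤ convexityGap p (fun j => (hσs j).1) (fun j => (hρs j).1) hσ.1 hρ.1 K
      (fun x => f (x + ε)) := by
  obtain ⟨a, ha, heq⟩ := convexityGap_shift_eq (p := p) hσs hρs hσ hρ K h hρsum
  rw [heq ε hε]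
  refine add_nonneg (mul_nonneg_of_nonpos_of_nonpos ha
    (convexityGap_id_nonpos hσs hρs hσ hρ K hp hρsum hσsum)) (integral_nonneg_of_ae ?_)
  filter_upwards [h.ae_nonneg] with t ht
  exact convexityGap_inv_add_nonneg hσs hρs hσ hρ K hp hρsum hσsum (by linarith)

/-- Both the linear part of `f` and the part of the `μ`-integral outside `S` contribute
nonnegatively to the defect, so they can be dropped. -/
lemma setIntegral_convexityGap_shift_le (h : IsCanonicalMeasure f μ) (hp : ∀ j, 0 ≤ p j)
    (hρsum : ρ = ∑ j, p j • ρs j) (hσsum : σ = ∑ j, p j • σs j) {ε : ℝ} (hε : 0 < ε)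
    {S : Set ℝ} {c : ℝ} (hc : 0 ≤ c)
    (hS : (volume : Measure ℝ).restrict S ≤ ENNReal.ofReal c • μ.restrict S) :
    ∫ t in S, convexityGap p (fun j => (hσs j).1) (fun j => (hρs j).1) hσ.1 hρ.1 K
        (fun x => 1 / (t + ε + x)) ≤
      c * convexityGap p (fun j => (hσs j).1) (fun j => (hρs j).1) hσ.1 hρ.1 K
        (fun x => f (x + ε)) := by
  obtain ⟨a, ha, heq⟩ := convexityGap_shift_eq (p := p) hσs hρs hσ hρ K h hρsum
  have hint := integrable_convexityGap_shift (p := p) hσs hρs hσ hρ K h hρsum hε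
  have hnn : 0 ≤ᵐ[μ] fun t => convexityGap p (fun j => (hσs j).1) (fun j => (hρs j).1) hσ.1 hρ.1 K
        (fun x => 1 / (t + ε + x)) := by
    filter_upwards [h.ae_nonneg] with t ht
    exact convexityGap_inv_add_nonneg hσs hρs hσ hρ K hp hρsum hσsum (by linarith)
  have hac : ENNReal.ofReal c • μ.restrict S ≪ μ :=
    (Measure.smul_absolutelyContinuous).trans Measure.absolutelyContinuous_restrict
  refine (integral_mono_measure hS (hac.ae_le hnn)
    (hint.restrict.smul_measure ENNReal.ofReal_ne_top)).trans ?_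
  rw [integral_smul_measure, ENNReal.toReal_ofReal hc, smul_eq_mul, heq ε hε]
  refine mul_le_mul_of_nonneg_left ((setIntegral_le_integral hint hnn).trans ?_) hc
  have := mul_nonneg_of_nonpos_of_nonpos ha
    (convexityGap_id_nonpos hσs hρs hσ hρ K hp hρsum hσsum)
  linarith

lemma setIntegral_convexityGap_le (h : IsCanonicalMeasure f μ) (hp : ∀ j, 0 ≤ p j)
    (hρsum : ρ = ∑ j, p j • ρs j) (hσsum : σ = ∑ j, p j • σs j) {E : ℝ}
    (hE : Tendsto (fun ε => convexityGap p (fun j => (hσs j).1) (fun j => (hρs j).1) hσ.1 hρ.1 K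
      (fun x => f (x + ε))) (𝓝[>] 0) (𝓝 E)) {l u c : ℝ} (hl : 0 < l) (hc : 0 ≤ c)
    (hS : (volume : Measure ℝ).restrict (Set.Icc l u) ≤
      ENNReal.ofReal c • μ.restrict (Set.Icc l u)) :
    ∫ t in Set.Icc l u, convexityGap p (fun j => (hσs j).1) (fun j => (hρs j).1) hσ.1 hρ.1 K
        (fun x => 1 / (t + x)) ≤ c * E := by
  -- For `t ≥ l > 0` the shifted kernels are at most `1 / l`, so their defects have a bound
  -- independent of `ε`.
  obtain ⟨M, hM⟩ := exists_abs_convexityGap_le (p := p) hσs hρs hσ hρ K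
  have hlim : Tendsto (fun ε => ∫ t in Set.Icc l u, convexityGap p (fun j => (hσs j).1)
      (fun j => (hρs j).1) hσ.1 hρ.1 K (fun x => 1 / (t + ε + x))) (𝓝[>] 0)
      (𝓝 (∫ t in Set.Icc l u, convexityGap p (fun j => (hσs j).1) (fun j => (hρs j).1) hσ.1 hρ.1 K
        (fun x => 1 / (t + x)))) := by
    refine tendsto_integral_filter_of_dominated_convergence (fun _ => M * (1 / l)) ?_ ?_
      (integrable_const _) ?_
    · filter_upwards with ε
      simp only [convexityGap, eigSum]
      fun_prop
    · filter_upwards [self_mem_nhdsWithin] with ε hε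
      refine (ae_restrict_iff' measurableSet_Icc).mpr (ae_of_all _ fun t ht => ?_)
      refine hM _ _ fun x hx => ?_
      have hε' : 0 < ε := hε
      have h1 : l ≤ t + ε + x := by linarith [ht.1]
      rw [abs_of_nonneg (one_div_nonneg.mpr (hl.le.trans h1))]
      exact one_div_le_one_div_of_le hl h1
    · refine (ae_restrict_iff' measurableSet_Icc).mpr (ae_of_all _ fun t ht => ?_)
      refine tendsto_convexityGap hσs hρs hσ hρ K fun x hx => ?_
      have h0 : t + x ≠ 0 := by linarith [ht.1]
      refine Tendsto.div tendsto_const_nhds ?_ h0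
      have : Tendsto (fun ε : ℝ => t + ε + x) (𝓝 0) (𝓝 (t + 0 + x)) :=
        Continuous.tendsto (by fun_prop) 0
      rw [add_zero] at this
      exact this.mono_left nhdsWithin_le_nhds
  refine le_of_tendsto_of_tendsto hlim (hE.const_mul c) ?_
  filter_upwards [self_mem_nhdsWithin] with ε hε
  exact setIntegral_convexityGap_shift_le hσs hρs hσ hρ K h hp hρsum hσsum hε hc hS

end GapIntegral

/-! ### The normalization of the integral for `x^β`. -/

section PowerIntegral

/-- The substitution `t = x / (1 - x)` gives the Beta integral `B(β, 1 - β) = Γ(β) Γ(1 - β)`,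
evaluated by the reflection formula. -/
lemma integral_rpowIntegrand₀₁_one {β : ℝ} (hβ0 : 0 < β) (hβ1 : β < 1) :
    ∫ t in Set.Ioi (0 : ℝ), Real.rpowIntegrand₀₁ β t 1 = Real.pi / Real.sin (β * Real.pi) := by
  have himg : (fun x : ℝ => x / (1 - x)) '' Set.Ioo 0 1 = Set.Ioi 0 := by
    ext y
    simp only [Set.mem_image, Set.mem_Ioo, Set.mem_Ioi]
    constructor
    · rintro ⟨x, hx, rfl⟩
      exact div_pos hx.1 (by linarith [hx.2])
    · intro hy
      have h1 : (1 + y) ≠ 0 := by positivity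
      refine ⟨y / (1 + y), ⟨by positivity, (div_lt_one (by positivity)).mpr (by linarith)⟩, ?_⟩
      have h2 : 1 - y / (1 + y) = 1 / (1 + y) := by field_simp; ring
      rw [h2]
      field_simp
  have hderiv : ∀ x ∈ Set.Ioo (0 : ℝ) 1, HasDerivWithinAt (fun x : ℝ => x / (1 - x))
      (1 / (1 - x) ^ 2) (Set.Ioo 0 1) x := by
    intro x hx
    have h1 : 1 - x ≠ 0 := by linarith [hx.2]
    have := (hasDerivAt_id x).div ((hasDerivAt_id x).const_sub 1) h1
    refine (this.congr_deriv ?_).hasDerivWithinAt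
    simp
  have hinj : Set.InjOn (fun x : ℝ => x / (1 - x)) (Set.Ioo 0 1) := by
    intro x hx y hy hxy
    have h1 : 1 - x ≠ 0 := by linarith [hx.2]
    have h2 : 1 - y ≠ 0 := by linarith [hy.2]
    simp only [div_eq_div_iff h1 h2] at hxy
    linarith
  rw [← himg, integral_image_eq_integral_abs_deriv_smul measurableSet_Ioo hderiv hinj]
  have hbeta : Real.pi / Real.sin (β * Real.pi) = (Complex.betaIntegral β (1 - β : ℝ)).re := by
    rw [← ProbabilityTheory.beta_eq_betaIntegralReal _ _ hβ0 (by linarith),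
      ProbabilityTheory.beta, Real.Gamma_mul_Gamma_one_sub]
    simp [mul_comm]
  rw [hbeta, Complex.betaIntegral, intervalIntegral.integral_of_le zero_le_one,
    integral_Ioc_eq_integral_Ioo]
  have hcast : ∫ x in Set.Ioo (0 : ℝ) 1, (x : ℂ) ^ ((β : ℂ) - 1) *
      (1 - (x : ℂ)) ^ (((1 - β : ℝ) : ℂ) - 1) =
      ((∫ x in Set.Ioo (0 : ℝ) 1, x ^ (β - 1) * (1 - x) ^ (-β) : ℝ) : ℂ) := by
    rw [← integral_complex_ofReal]
    refine setIntegral_congr_fun measurableSet_Ioo fun x hx => ?_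
    rw [Complex.ofReal_mul, Complex.ofReal_cpow hx.1.le,
      Complex.ofReal_cpow (by linarith [hx.2] : 0 ≤ 1 - x)]
    push_cast
    congr 2
    ring
  rw [hcast, Complex.ofReal_re]
  refine setIntegral_congr_fun measurableSet_Ioo fun x hx => ?_
  have h1 : 0 < 1 - x := by linarith [hx.2]
  have hpos : 0 < x / (1 - x) := div_pos hx.1 h1
  rw [Real.rpowIntegrand₀₁_eq_pow_div ⟨hβ0, hβ1⟩ hpos.le zero_le_one, abs_of_nonneg (by positivity),
    Real.div_rpow hx.1.le h1.le, Real.rpow_sub_one h1.ne', Real.rpow_neg h1.le, smul_eq_mul]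
  have h2 : x / (1 - x) + 1 = 1 / (1 - x) := by field_simp; ring
  have h3 : (1 - x) ^ β ≠ 0 := (Real.rpow_pos_of_pos h1 _).ne'
  rw [h2]
  field_simp

end PowerIntegral

/-! ### Power products as integrals of resolvents in Hilbert–Schmidt norm. -/

section Frobenius

variable {n : Type*} [Fintype n]

/-- A matrix as a vector of the Euclidean space whose norm is the Hilbert–Schmidt norm. -/
noncomputable def hsVec : Matrix n n ℂ →ₗ[ℝ] EuclideanSpace ℂ (n × n) where
  toFun A := WithLp.toLp 2 fun x => A x.1 x.2
  map_add' _ _ := rfl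
  map_smul' _ _ := rfl

lemma hsNorm_eq_norm (A : Matrix n n ℂ) : hsNorm A = ‖hsVec A‖ := by
  rw [EuclideanSpace.norm_eq, hsNorm]
  congr 1
  simp only [Matrix.trace, Matrix.diag_apply, Matrix.mul_apply, Matrix.conjTranspose_apply,
    Complex.re_sum, hsVec, Fintype.sum_prod_type]
  rw [Finset.sum_comm]
  refine Finset.sum_congr rfl fun i _ => Finset.sum_congr rfl fun k _ => ?_
  rw [Complex.sq_norm, Complex.normSq_apply]
  simp
  rfl

lemma hsNorm_nonneg (A : Matrix n n ℂ) : 0 ≤ hsNorm A := Real.sqrt_nonneg _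

lemma hsNorm_sub_le (A B : Matrix n n ℂ) : hsNorm (A - B) ≤ hsNorm A + hsNorm B := by
  simp only [hsNorm_eq_norm, map_sub]
  exact norm_sub_le _ _

lemma hsNorm_smul (a : ℝ) (A : Matrix n n ℂ) : hsNorm (a • A) = |a| * hsNorm A := by
  simp only [hsNorm_eq_norm, map_smul]
  exact norm_smul a _

variable [DecidableEq n]

lemma hsVec_schurMul_mul {σ ρ : Matrix n n ℂ} (hσ : σ.IsHermitian) (hρ : ρ.IsHermitian)
    (K M : Matrix n n ℂ) (h : n → n → ℝ) : hsVec (schurMul hσ hρ K h * M) = ∑ k, ∑ i, h k i •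
    hsVec ((hσ.eigenvectorUnitary : Matrix n n ℂ) * Matrix.single k i (eigCoeff hσ hρ K k i) *
      star (hρ.eigenvectorUnitary : Matrix n n ℂ) * M) := by
  simp only [schurMul_eq_sum, Matrix.sum_mul, map_sum, smul_mul_assoc, map_smul]

lemma integrable_schurMul {σ ρ : Matrix n n ℂ} (hσ : σ.IsHermitian) (hρ : ρ.IsHermitian)
    (K M : Matrix n n ℂ) {μ : Measure ℝ} {G : ℝ → n → n → ℝ}
    (hG : ∀ k i, Integrable (fun t => G t k i) μ) :
    Integrable (fun t => hsVec (schurMul hσ hρ K (G t) * M)) μ := by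
  simp only [hsVec_schurMul_mul]
  exact integrable_finsetSum _ fun k _ => integrable_finsetSum _ fun i _ => (hG k i).smul_const _

lemma integral_schurMul {σ ρ : Matrix n n ℂ} (hσ : σ.IsHermitian) (hρ : ρ.IsHermitian)
    (K M : Matrix n n ℂ) {μ : Measure ℝ} {G : ℝ → n → n → ℝ}
    (hG : ∀ k i, Integrable (fun t => G t k i) μ) :
    ∫ t, hsVec (schurMul hσ hρ K (G t) * M) ∂μ =
      hsVec (schurMul hσ hρ K (fun k i => ∫ t, G t k i ∂μ) * M) := by
  simp only [hsVec_schurMul_mul]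
  rw [integral_finsetSum _ fun k _ => integrable_finsetSum _ fun i _ => (hG k i).smul_const _]
  refine Finset.sum_congr rfl fun k _ => ?_
  rw [integral_finsetSum _ fun i _ => (hG k i).smul_const _]
  exact Finset.sum_congr rfl fun i _ => integral_smul_const _ _

/-- The integrand of the integral representation of `σ^β K ρ^{-β}`. -/
noncomputable def powerIntegrand {σ ρ : Matrix n n ℂ} (hσ : σ.IsHermitian) (hρ : ρ.IsHermitian)
    (β t : ℝ) (k i : n) : ℝ :=
  if hρ.eigenvalues i = 0 then 0 else
    Real.rpowIntegrand₀₁ β t (hσ.eigenvalues k / hρ.eigenvalues i)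

variable {σ ρ : Matrix n n ℂ} {β : ℝ}

lemma integrable_powerIntegrand (hσ : σ.PosSemidef) (hρ : ρ.PosSemidef) (hβ0 : 0 < β)
    (hβ1 : β < 1) (k i : n) :
    IntegrableOn (fun t => powerIntegrand hσ.1 hρ.1 β t k i) (Set.Ioi 0) := by
  unfold powerIntegrand
  split_ifs
  · exact integrable_zero _ _ _
  · exact Real.integrableOn_rpowIntegrand₀₁_Ioi ⟨hβ0, hβ1⟩
      (div_nonneg (hσ.eigenvalues_nonneg k) (hρ.eigenvalues_nonneg i))

lemma psdPow_mul_mul_psdPow (hσ : σ.PosSemidef) (hρ : ρ.PosSemidef) (hβ0 : 0 < β)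
    (hβ1 : β < 1) (K : Matrix n n ℂ) :
    psdPow σ β * K * psdPow ρ (-β) = (Real.sin (β * Real.pi) / Real.pi) •
      schurMul hσ.1 hρ.1 K
        (fun k i => ∫ t in Set.Ioi 0, powerIntegrand hσ.1 hρ.1 β t k i) := by
  rw [mul_assoc, psdPow, psdPow, mul_cfc_eq_schurMul hσ.1 hρ.1, cfc_mul_schurMul, schurMul_smul]
  congr
  ext k i
  simp only [powerIntegrand]
  by_cases hi : hρ.1.eigenvalues i = 0
  · simp [hi]
  have hr := lt_of_le_of_ne (hρ.eigenvalues_nonneg i) (Ne.symm hi)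
  have hs := hσ.eigenvalues_nonneg k
  have hmain := Real.rpow_eq_const_mul_integral (p := β) ⟨hβ0, hβ1⟩ (div_nonneg hs hr.le)
  rw [integral_rpowIntegrand₀₁_one hβ0 hβ1, inv_div] at hmain
  simp only [hi, if_false]
  rw [← hmain, Real.div_rpow hs hr.le, Real.rpow_neg hr.le]
  split_ifs with hk
  · simp [hk, Real.zero_rpow hβ0.ne']
  · rfl

lemma schurMul_powerIntegrand (hσ : σ.PosSemidef) (hρ : ρ.PosSemidef) (K : Matrix n n ℂ) {t : ℝ}
    (ht : 0 < t) : schurMul hσ.1 hρ.1 K (powerIntegrand hσ.1 hρ.1 β t) =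
      t ^ β • (t⁻¹ • (K * psdPow ρ 0) - resolventMul hσ.1 hρ.1 K t) := by
  rw [psdPow, mul_cfc_eq_schurMul hσ.1 hρ.1, resolventMul, schurMul_smul, schurMul_sub,
    schurMul_smul]
  congr
  ext k i
  simp only [powerIntegrand]
  split_ifs with hi
  · simp [hi]
  have hr := lt_of_le_of_ne (hρ.eigenvalues_nonneg i) (Ne.symm hi)
  have hs := hσ.eigenvalues_nonneg k
  rw [Real.rpowIntegrand₀₁, Real.rpow_zero, mul_one]
  congr 2
  have h1 : t + hσ.1.eigenvalues k / hρ.1.eigenvalues i ≠ 0 := by positivity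
  have h2 : t * hρ.1.eigenvalues i + hσ.1.eigenvalues k ≠ 0 := by positivity
  field_simp

/-- The operators `σ^β K ρ^{-β} τ^{1/2}` and `σ'^β K τ^{1/2-β}` differ by at most the integral of
the difference of the resolvents. -/
lemma hsNorm_psdPow_sub_le {σ' τ : Matrix n n ℂ} (hσ : σ.PosSemidef) (hρ : ρ.PosSemidef)
    (hσ' : σ'.PosSemidef) (hτ : τ.PosSemidef) (hβ0 : 0 < β) (hβ1 : β < 1) (K : Matrix n n ℂ)
    (hsupp : psdPow ρ 0 * psdPow τ (1 / 2) = psdPow τ (1 / 2)) :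
    IntegrableOn (fun t => t ^ β * hsNorm ((resolventMul hσ.1 hρ.1 K t -
        resolventMul hσ'.1 hτ.1 K t) * psdPow τ (1 / 2))) (Set.Ioi 0) ∧
    hsNorm (psdPow σ β * K * psdPow ρ (-β) * psdPow τ (1 / 2)
      - psdPow σ' β * K * psdPow τ (1 / 2 - β)) ≤ Real.sin (β * Real.pi) / Real.pi *
    ∫ t in Set.Ioi 0, t ^ β * hsNorm ((resolventMul hσ.1 hρ.1 K t -
        resolventMul hσ'.1 hτ.1 K t) * psdPow τ (1 / 2)) := by
  set M := psdPow τ (1 / 2) with hM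
  have hint1 := integrable_schurMul hσ.1 hρ.1 K M
    (integrable_powerIntegrand hσ hρ hβ0 hβ1)
  have hint2 := integrable_schurMul hσ'.1 hτ.1 K M
    (integrable_powerIntegrand hσ' hτ hβ0 hβ1)
  have hτ0 : psdPow τ 0 * M = M := by rw [hM, psdPow_mul_psdPow hτ, zero_add]
  have hnorm : ∀ t ∈ Set.Ioi (0 : ℝ), ‖hsVec (schurMul hσ.1 hρ.1 K (powerIntegrand hσ.1 hρ.1 β t) * M) -
      hsVec (schurMul hσ'.1 hτ.1 K (powerIntegrand hσ'.1 hτ.1 β t) * M)‖ =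
      t ^ β * hsNorm ((resolventMul hσ.1 hρ.1 K t - resolventMul hσ'.1 hτ.1 K t) * M) := by
    intro t ht
    rw [schurMul_powerIntegrand hσ hρ K ht, schurMul_powerIntegrand hσ' hτ K ht]
    -- After multiplication by `M` both support projections disappear, so the terms `t⁻¹ K` cancel
    -- and only the resolvents remain.
    have : (t ^ β • (t⁻¹ • (K * psdPow ρ 0) - resolventMul hσ.1 hρ.1 K t)) * M -
        (t ^ β • (t⁻¹ • (K * psdPow τ 0) - resolventMul hσ'.1 hτ.1 K t)) * M =
        (-t ^ β) • ((resolventMul hσ.1 hρ.1 K t - resolventMul hσ'.1 hτ.1 K t) * M) := by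
      simp only [smul_mul_assoc, sub_mul, mul_assoc, hsupp, hτ0, smul_sub, neg_smul]
      abel
    rw [← map_sub, this, ← hsNorm_eq_norm, hsNorm_smul, abs_neg, abs_of_pos (Real.rpow_pos_of_pos ht _)]
  have hsin : 0 ≤ Real.sin (β * Real.pi) / Real.pi :=
    div_nonneg (Real.sin_nonneg_of_nonneg_of_le_pi (by positivity)
      (by nlinarith [Real.pi_pos])) Real.pi_pos.le
  refine ⟨(hint1.sub hint2).norm.congr
    ((ae_restrict_iff' measurableSet_Ioi).mpr (ae_of_all _ hnorm)), ?_⟩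
  have hpow : psdPow σ' β * K * psdPow τ (1 / 2 - β) = psdPow σ' β * K * psdPow τ (-β) * M := by
    rw [mul_assoc _ _ M, hM, psdPow_mul_psdPow hτ]
    congr 2
    ring
  rw [hpow, psdPow_mul_mul_psdPow hσ hρ hβ0 hβ1, psdPow_mul_mul_psdPow hσ' hτ hβ0 hβ1,
    smul_mul_assoc, smul_mul_assoc, ← smul_sub, hsNorm_smul, abs_of_nonneg hsin, hsNorm_eq_norm, map_sub,
    ← integral_schurMul hσ.1 hρ.1 K M (integrable_powerIntegrand hσ hρ hβ0 hβ1),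
    ← integral_schurMul hσ'.1 hτ.1 K M (integrable_powerIntegrand hσ' hτ hβ0 hβ1),
    ← integral_sub hint1 hint2]
  refine mul_le_mul_of_nonneg_left ((norm_integral_le_integral_norm _).trans_eq ?_) hsin
  exact setIntegral_congr_fun measurableSet_Ioi hnorm

end Frobenius

/-! ### Supports and smallest non-zero eigenvalues. -/

section Support

variable {n : Type*} [Fintype n] [DecidableEq n] {ρ τ : Matrix n n ℂ}

/-- The columns of `1 - ρ⁰` lie in the kernel of `ρ`, hence in that of `τ`, and `τ^s` factors as
`τ^(s-1) τ`. -/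
lemma psdPow_mul_support (hρ : ρ.PosSemidef) (hτ : τ.PosSemidef)
    (hker : ∀ v : n → ℂ, ρ *ᵥ v = 0 → τ *ᵥ v = 0) (s : ℝ) :
    psdPow τ s * psdPow ρ 0 = psdPow τ s := by
  have h1 : ρ * (1 - psdPow ρ 0) = 0 := by
    have := psdPow_mul_psdPow hρ 1 0
    rw [add_zero, psdPow_one hρ] at this
    rw [mul_sub, mul_one, this, sub_self]
  have h2 : τ * (1 - psdPow ρ 0) = 0 := by
    ext i k
    have hcol : ρ *ᵥ (1 - psdPow ρ 0).col k = 0 := by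
      ext l
      exact congrFun (congrFun h1 l) k
    exact congrFun (hker _ hcol) i
  have h3 : psdPow τ s = psdPow τ (s - 1) * τ := by
    have := psdPow_mul_psdPow hτ (s - 1) 1
    rw [psdPow_one hτ, sub_add_cancel] at this
    exact this.symm
  have h4 : psdPow τ s * (1 - psdPow ρ 0) = 0 := by rw [h3, mul_assoc, h2, mul_zero]
  rw [mul_sub, mul_one, sub_eq_zero] at h4
  exact h4.symm

lemma support_mul_psdPow (hρ : ρ.PosSemidef) (hτ : τ.PosSemidef)
    (hker : ∀ v : n → ℂ, ρ *ᵥ v = 0 → τ *ᵥ v = 0) (s : ℝ) :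
    psdPow ρ 0 * psdPow τ s = psdPow τ s := by
  have := congrArg Matrix.conjTranspose (psdPow_mul_support hρ hτ hker s)
  rwa [Matrix.conjTranspose_mul, (psdPow_isHermitian _ _).eq, (psdPow_isHermitian _ _).eq] at this

omit [DecidableEq n] in
lemma mulVec_eq_zero_of_sum {ι : Type*} [Fintype ι] {p : ι → ℝ} (hp : ∀ j, 0 < p j)
    {ρs : ι → Matrix n n ℂ} (hρs : ∀ j, (ρs j).PosSemidef) (hρsum : ρ = ∑ j, p j • ρs j)
    (j : ι) (v : n → ℂ) (hv : ρ *ᵥ v = 0) : ρs j *ᵥ v = 0 := by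
  have h1 : ∑ j, p j * (star v ⬝ᵥ ρs j *ᵥ v).re = 0 := by
    have : (star v ⬝ᵥ ρ *ᵥ v).re = 0 := by simp [hv]
    rw [hρsum, Matrix.sum_mulVec, dotProduct_sum, Complex.re_sum] at this
    simpa [Matrix.smul_mulVec, dotProduct_smul] using this
  have h2 := (Finset.sum_eq_zero_iff_of_nonneg fun j _ =>
    mul_nonneg (hp j).le ((hρs j).re_dotProduct_nonneg v)).mp h1 j (Finset.mem_univ j)
  have h3 : (star v ⬝ᵥ ρs j *ᵥ v).re = 0 := (mul_eq_zero.mp h2).resolve_left (hp j).ne'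
  refine ((hρs j).dotProduct_mulVec_zero_iff v).mp (Complex.ext h3 ?_)
  exact (Complex.le_def.mp ((hρs j).dotProduct_mulVec_nonneg v)).2.symm

lemma minNonzeroEigenvalue_le (hρ : ρ.IsHermitian) {i : n} (hi : hρ.eigenvalues i ≠ 0) :
    minNonzeroEigenvalue ρ ≤ hρ.eigenvalues i :=
  csInf_le (Matrix.finite_real_spectrum.subset Set.sdiff_subset).bddBelow
    ⟨hρ.eigenvalues_mem_spectrum_real i, hi⟩

lemma minNonzeroEigenvalue_mem (hρ : IsState ρ) :
    ∃ i, hρ.1.1.eigenvalues i ≠ 0 ∧ minNonzeroEigenvalue ρ = hρ.1.1.eigenvalues i := by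
  have hne : (spectrum ℝ ρ \ {0}).Nonempty := by
    by_contra h
    have h0 : ∀ i, hρ.1.1.eigenvalues i = 0 := by
      intro i
      by_contra hi
      exact h ⟨_, hρ.1.1.eigenvalues_mem_spectrum_real i, hi⟩
    have := hρ.1.1.trace_eq_sum_eigenvalues
    simp [h0, hρ.2] at this
  have hmem := hne.csInf_mem (Matrix.finite_real_spectrum.subset Set.sdiff_subset)
  rw [hρ.1.1.spectrum_real_eq_range_eigenvalues] at hmem
  obtain ⟨⟨i, hi⟩, hi0⟩ := hmem
  refine ⟨i, ?_, ?_⟩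
  · rw [hi]; exact hi0
  · rw [minNonzeroEigenvalue, hρ.1.1.spectrum_real_eq_range_eigenvalues, hi]

lemma minNonzeroEigenvalue_pos (hρ : IsState ρ) : 0 < minNonzeroEigenvalue ρ := by
  obtain ⟨i, hi, h⟩ := minNonzeroEigenvalue_mem hρ
  rw [h]
  exact lt_of_le_of_ne (hρ.1.eigenvalues_nonneg i) (Ne.symm hi)

lemma posSemidef_sub_smul_support (hρ : ρ.PosSemidef) :
    (ρ - minNonzeroEigenvalue ρ • psdPow ρ 0).PosSemidef := by
  have hfin : (spectrum ℝ ρ).Finite := Matrix.finite_real_spectrum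
  have h1 : ρ - minNonzeroEigenvalue ρ • psdPow ρ 0 = cfc (fun x : ℝ =>
      id x - minNonzeroEigenvalue ρ * (if x = 0 then 0 else x ^ (0 : ℝ))) ρ := by
    rw [cfc_sub _ _ ρ (hfin.continuousOn _) (hfin.continuousOn _),
      cfc_const_mul _ _ ρ (hfin.continuousOn _), cfc_id ℝ ρ hρ.1.isSelfAdjoint, psdPow]
  rw [h1, hρ.1.cfc_eq_conj]
  refine Matrix.PosSemidef.mul_mul_conjTranspose_same
    (Matrix.PosSemidef.diagonal fun i => ?_) _
  simp only [Pi.zero_apply, Complex.zero_le_real, id]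
  split_ifs with hi
  · simp [hi]
  · simpa using minNonzeroEigenvalue_le hρ.1 hi

/-- A unit eigenvector of `ρ` for its smallest non-zero eigenvalue lies in the support of `τ` by
`hker`; test `ρ ≥ q τ` and `τ ≥ λ_τ τ⁰` on it, with `λ_τ` the smallest non-zero eigenvalue of `τ`.
-/
lemma mul_minNonzeroEigenvalue_le (hρ : IsState ρ) (hτ : τ.PosSemidef) {q : ℝ} (hq : 0 ≤ q)
    (hle : (ρ - q • τ).PosSemidef) (hker : ∀ v : n → ℂ, τ *ᵥ v = 0 → ρ *ᵥ v = 0) :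
    q * minNonzeroEigenvalue τ ≤ minNonzeroEigenvalue ρ := by
  obtain ⟨i, hi, heq⟩ := minNonzeroEigenvalue_mem hρ
  rw [heq]
  set v : n → ℂ := (hρ.1.1.eigenvectorBasis i).ofLp with hv
  have hρv : ρ *ᵥ v = hρ.1.1.eigenvalues i • v := hρ.1.1.mulVec_eigenvectorBasis i
  have hvv : star v ⬝ᵥ v = 1 := by
    have := hρ.1.1.eigenvectorBasis.orthonormal.1 i
    have h2 : inner ℂ (hρ.1.1.eigenvectorBasis i) (hρ.1.1.eigenvectorBasis i) = (1 : ℂ) := by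
      rw [inner_self_eq_norm_sq_to_K, this]; simp
    rw [EuclideanSpace.inner_eq_star_dotProduct, dotProduct_comm] at h2
    exact h2
  have hPv : psdPow τ 0 *ᵥ v = v := by
    have h1 := support_mul_psdPow hτ hρ.1 hker 1
    rw [psdPow_one hρ.1] at h1
    have h2 : psdPow τ 0 *ᵥ (ρ *ᵥ v) = ρ *ᵥ v := by rw [Matrix.mulVec_mulVec, h1]
    rw [hρv, Matrix.mulVec_smul] at h2
    exact smul_right_injective _ hi h2
  have h1 := hle.re_dotProduct_nonneg v
  have h2 := (posSemidef_sub_smul_support hτ).re_dotProduct_nonneg v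
  simp only [Matrix.sub_mulVec, Matrix.smul_mulVec, hρv, hPv, dotProduct_sub, dotProduct_smul,
    hvv, map_sub, RCLike.re_to_complex, Complex.smul_re, Complex.one_re, smul_eq_mul,
    mul_one] at h1 h2
  nlinarith

end Support

/-! ### A priori bounds on resolvents and remainders. -/

section Bounds

variable {n : Type*} [Fintype n] [DecidableEq n] {ρ σ : Matrix n n ℂ}

lemma opNorm_nonneg (K : Matrix n n ℂ) : 0 ≤ opNorm K := norm_nonneg _

omit [DecidableEq n] in
lemma hsNorm_sq_eq_sum_col (A : Matrix n n ℂ) :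
    hsNorm A ^ 2 = ∑ i, ‖WithLp.toLp 2 (A.col i)‖ ^ 2 := by
  rw [hsNorm_eq_norm, EuclideanSpace.norm_sq_eq, Fintype.sum_prod_type, Finset.sum_comm]
  refine Finset.sum_congr rfl fun i _ => ?_
  rw [EuclideanSpace.norm_sq_eq]
  rfl

lemma hsNorm_mul_le (K A : Matrix n n ℂ) : hsNorm (K * A) ≤ opNorm K * hsNorm A := by
  refine (pow_le_pow_iff_left₀ (hsNorm_nonneg _)
    (mul_nonneg (opNorm_nonneg K) (hsNorm_nonneg A)) two_ne_zero).mp ?_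
  rw [mul_pow, hsNorm_sq_eq_sum_col, hsNorm_sq_eq_sum_col, Finset.mul_sum]
  refine Finset.sum_le_sum fun i _ => ?_
  rw [← mul_pow]
  have : WithLp.toLp 2 ((K * A).col i) =
      Matrix.toEuclideanCLM (n := n) (𝕜 := ℂ) K (WithLp.toLp 2 (A.col i)) := by
    rw [Matrix.toEuclideanCLM_toLp]
    rfl
  rw [this]
  gcongr
  exact ContinuousLinearMap.le_opNorm _ _

lemma hsNorm_sqrt_of_isState (hρ : IsState ρ) : hsNorm (psdPow ρ (1 / 2)) = 1 := by
  have h1 : hsNorm (psdPow ρ (1 / 2)) ^ 2 = 1 := by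
    rw [hsNorm_sq, (psdPow_isHermitian _ _).eq, psdPow_half_mul_self hρ.1, hρ.2, Complex.one_re]
  nlinarith [hsNorm_nonneg (psdPow ρ (1 / 2))]

/-- Right multiplication by `ρ^{1/2}` kills the entries with `r_i = 0`. The others are compared with
those of `K ρ^{1/2}`, whose norm is at most `‖K‖` as `ρ` has trace one. -/
lemma hsNorm_schurMul_mul_sqrt_le (hσ : σ.PosSemidef) (hρ : IsState ρ) (K : Matrix n n ℂ)
    {h : n → n → ℝ} {B : ℝ} (hB : 0 ≤ B)
    (H : ∀ k i, hρ.1.1.eigenvalues i ≠ 0 → |h k i| ≤ B) :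
    hsNorm (schurMul hσ.1 hρ.1.1 K h * psdPow ρ (1 / 2)) ≤ B * opNorm K := by
  have h1 : hsNorm (K * psdPow ρ (1 / 2)) ≤ opNorm K := by
    simpa only [hsNorm_sqrt_of_isState hρ, mul_one] using hsNorm_mul_le K (psdPow ρ (1 / 2))
  refine le_trans ((pow_le_pow_iff_left₀ (hsNorm_nonneg _)
    (mul_nonneg hB (hsNorm_nonneg _)) two_ne_zero).mp ?_)
    (mul_le_mul_of_nonneg_left h1 hB)
  rw [mul_pow, psdPow, schurMul_mul_cfc, mul_cfc_eq_schurMul hσ.1 hρ.1.1, hsNorm_schurMul_sq,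
    hsNorm_schurMul_sq, Finset.mul_sum]
  refine Finset.sum_le_sum fun k _ => ?_
  rw [Finset.mul_sum]
  refine Finset.sum_le_sum fun i _ => ?_
  rw [← mul_assoc, mul_pow]
  refine mul_le_mul_of_nonneg_right ?_ (eigWeight_nonneg _ _ _ _ _)
  by_cases hi : hρ.1.1.eigenvalues i = 0
  · simp [hi]
  · refine mul_le_mul_of_nonneg_right ?_ (sq_nonneg _)
    rw [← sq_abs]
    gcongr
    exact H k i hi

lemma hsNorm_resolventMul_le (hσ : σ.PosSemidef) (hρ : IsState ρ) (K : Matrix n n ℂ) {t : ℝ}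
    (ht : 0 < t) :
    hsNorm (resolventMul hσ.1 hρ.1.1 K t * psdPow ρ (1 / 2)) ≤ 1 / t * opNorm K := by
  refine hsNorm_schurMul_mul_sqrt_le hσ hρ K (by positivity) fun k i hi => ?_
  have hr := lt_of_le_of_ne (hρ.1.eigenvalues_nonneg i) (Ne.symm hi)
  have hs := hσ.eigenvalues_nonneg k
  rw [abs_of_nonneg (by positivity), div_le_div_iff₀ (by positivity) ht]
  nlinarith

lemma eigenvalues_le_one (hσ : IsState σ) (k : n) : hσ.1.1.eigenvalues k ≤ 1 := by
  have h := hσ.1.1.trace_eq_sum_eigenvalues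
  have h1 : ∑ i, hσ.1.1.eigenvalues i = 1 := by
    have := congrArg Complex.re (h.symm.trans hσ.2)
    simpa using this
  rw [← h1]
  exact Finset.single_le_sum (fun i _ => hσ.1.eigenvalues_nonneg i) (Finset.mem_univ k)

/-- The remainder `K ρ⁰ - t (t + Δ)⁻¹ K = Δ (t + Δ)⁻¹ K`. -/
noncomputable def resolventRemainder (hσ : σ.IsHermitian) (hρ : ρ.IsHermitian) (K : Matrix n n ℂ)
    (t : ℝ) : Matrix n n ℂ :=
  schurMul hσ hρ K (fun k i => if hρ.eigenvalues i = 0 then 0 else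
    hσ.eigenvalues k / (t * hρ.eigenvalues i + hσ.eigenvalues k))

lemma smul_resolventMul (hσ : σ.PosSemidef) (hρ : ρ.PosSemidef) (K : Matrix n n ℂ) {t : ℝ}
    (ht : 0 < t) : t • resolventMul hσ.1 hρ.1 K t =
      K * psdPow ρ 0 - resolventRemainder hσ.1 hρ.1 K t := by
  rw [psdPow, mul_cfc_eq_schurMul hσ.1 hρ.1, resolventMul, resolventRemainder, schurMul_smul,
    schurMul_sub]
  congr
  ext k i
  split_ifs with hi
  · simp [hi]
  have hr := lt_of_le_of_ne (hρ.eigenvalues_nonneg i) (Ne.symm hi)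
  have hs := hσ.eigenvalues_nonneg k
  have h2 : t * hρ.1.eigenvalues i + hσ.1.eigenvalues k ≠ 0 := by positivity
  rw [Real.rpow_zero]
  field_simp
  ring

/-- On the support of `ρ` the eigenvalues of `Δ` are at most `1 / λ`, because those of `σ` are at
most one, and `x / (t + x) ≤ x / t`. -/
lemma hsNorm_resolventRemainder_le (hσ : IsState σ) (hρ : IsState ρ) (K : Matrix n n ℂ) {t : ℝ}
    (ht : 0 < t) :
    hsNorm (resolventRemainder hσ.1.1 hρ.1.1 K t * psdPow ρ (1 / 2)) ≤
      1 / t * (minNonzeroEigenvalue ρ)⁻¹ * opNorm K := by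
  have hpos := minNonzeroEigenvalue_pos hρ
  refine hsNorm_schurMul_mul_sqrt_le hσ.1 hρ K (by positivity) fun k i hi => ?_
  have hr := minNonzeroEigenvalue_le hρ.1.1 hi
  have hs := hσ.1.eigenvalues_nonneg k
  have hs1 := eigenvalues_le_one hσ k
  have hr0 := hpos.trans_le hr
  rw [if_neg hi, abs_of_nonneg (by positivity), one_div, ← mul_inv, ← one_div,
    div_le_div_iff₀ (by positivity) (by positivity)]
  have h1 : t * minNonzeroEigenvalue ρ ≤ t * hρ.1.1.eigenvalues i :=
    mul_le_mul_of_nonneg_left hr ht.le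
  have h2 : 0 < t * minNonzeroEigenvalue ρ := by positivity
  nlinarith

end Bounds

/-! ### Bounds on the weighted resolvent differences. -/

section Mixture

variable {ι n : Type*} [Fintype ι] [Fintype n] [DecidableEq n] {p : ι → ℝ}
  {ρs σs : ι → Matrix n n ℂ} {ρ σ : Matrix n n ℂ}

lemma sum_sqrt_mul_le (hp : ∀ j, 0 ≤ p j) (x : ι → ℝ) :
    ∑ j, p j ^ (1 / 2 : ℝ) * x j ≤ √(Fintype.card ι : ℝ) * √(∑ j, p j * x j ^ 2) := by
  have h := Real.sum_mul_le_sqrt_mul_sqrt Finset.univ (fun _ : ι => (1 : ℝ))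
    (fun j => p j ^ (1 / 2 : ℝ) * x j)
  simp only [one_mul, one_pow, Finset.sum_const, Finset.card_univ, nsmul_eq_mul, mul_one] at h
  refine h.trans_eq ?_
  congr 2
  refine Finset.sum_congr rfl fun j _ => ?_
  rw [mul_pow, ← Real.sqrt_eq_rpow, Real.sq_sqrt (hp j)]

lemma sum_mul_hsNorm_sq (hρs : ∀ j, (ρs j).PosSemidef) (hρ : ρ.PosSemidef)
    (hρsum : ρ = ∑ j, p j • ρs j) (X : Matrix n n ℂ) :
    ∑ j, p j * hsNorm (X * psdPow (ρs j) (1 / 2)) ^ 2 = hsNorm (X * psdPow ρ (1 / 2)) ^ 2 := by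
  simp only [hsNorm_mul_sqrt_sq (hρs _), hsNorm_mul_sqrt_sq hρ]
  conv_rhs => rw [hρsum]
  rw [Matrix.mul_sum, hsInner_sum_right]
  refine Finset.sum_congr rfl fun j _ => ?_
  rw [mul_smul_comm, hsInner_smul_right]

lemma sum_sqrt_mul_hsNorm_le (hp : ∀ j, 0 ≤ p j) (hρs : ∀ j, (ρs j).PosSemidef)
    (hρ : ρ.PosSemidef) (hρsum : ρ = ∑ j, p j • ρs j) (X : Matrix n n ℂ) :
    ∑ j, p j ^ (1 / 2 : ℝ) * hsNorm (X * psdPow (ρs j) (1 / 2)) ≤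
      √(Fintype.card ι : ℝ) * hsNorm (X * psdPow ρ (1 / 2)) := by
  refine (sum_sqrt_mul_le hp _).trans_eq ?_
  rw [sum_mul_hsNorm_sq hρs hρ hρsum, Real.sqrt_sq (hsNorm_nonneg _)]

/-- The weighted sum of the norms of the differences of resolvents. -/
noncomputable def resolventDefect (p : ι → ℝ) (hσs : ∀ j, (σs j).IsHermitian)
    (hρs : ∀ j, (ρs j).IsHermitian) (hσ : σ.IsHermitian) (hρ : ρ.IsHermitian) (K : Matrix n n ℂ)
    (t : ℝ) : ℝ :=
  ∑ j, p j ^ (1 / 2 : ℝ) * hsNorm ((resolventMul hσ hρ K t -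
    resolventMul (hσs j) (hρs j) K t) * psdPow (ρs j) (1 / 2))

variable (hσs : ∀ j, IsState (σs j)) (hρs : ∀ j, IsState (ρs j)) (hσ : IsState σ)
  (hρ : IsState ρ) (K : Matrix n n ℂ)

lemma resolventDefect_le_sqrt_gap (hp : ∀ j, 0 ≤ p j) (hρsum : ρ = ∑ j, p j • ρs j)
    (hσsum : σ = ∑ j, p j • σs j) {t : ℝ} (ht : 0 < t) :
    resolventDefect p (fun j => (hσs j).1.1) (fun j => (hρs j).1.1) hσ.1.1 hρ.1.1 K t ≤
      √(Fintype.card ι : ℝ) * √(convexityGap p (fun j => (hσs j).1.1) (fun j => (hρs j).1.1)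
        hσ.1.1 hρ.1.1 K (fun x => 1 / (t + x)) / t) := by
  refine (sum_sqrt_mul_le hp _).trans ?_
  gcongr
  rw [le_div_iff₀ ht, mul_comm]
  exact le_convexityGap_inv_add (fun j => (hσs j).1) (fun j => (hρs j).1) hσ.1 hρ.1 K hp hρsum
    hσsum ht

lemma sum_sqrt_le_sqrt_card (hp : ∀ j, 0 ≤ p j) (hp1 : ∑ j, p j = 1) :
    ∑ j, p j ^ (1 / 2 : ℝ) ≤ √(Fintype.card ι : ℝ) := by
  simpa [hp1] using sum_sqrt_mul_le hp (fun _ => 1)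

lemma resolventDefect_le_inv (hp : ∀ j, 0 ≤ p j) (hp1 : ∑ j, p j = 1)
    (hρsum : ρ = ∑ j, p j • ρs j) {t : ℝ} (ht : 0 < t) :
    resolventDefect p (fun j => (hσs j).1.1) (fun j => (hρs j).1.1) hσ.1.1 hρ.1.1 K t ≤
      2 * √(Fintype.card ι : ℝ) * opNorm K * (1 / t) := by
  have h1 := sum_sqrt_mul_hsNorm_le hp (fun j => (hρs j).1) hρ.1 hρsum
    (resolventMul hσ.1.1 hρ.1.1 K t)
  have h2 := hsNorm_resolventMul_le hσ.1 hρ K ht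
  have h3 := fun j => hsNorm_resolventMul_le (hσs j).1 (hρs j) K ht
  have hκ := opNorm_nonneg K
  have hN := Real.sqrt_nonneg (Fintype.card ι : ℝ)
  have hpj := fun j => Real.rpow_nonneg (hp j) (1 / 2)
  calc _ ≤ ∑ j, (p j ^ (1 / 2 : ℝ) * hsNorm (resolventMul hσ.1.1 hρ.1.1 K t *
          psdPow (ρs j) (1 / 2)) + p j ^ (1 / 2 : ℝ) * (1 / t * opNorm K)) := by
        refine Finset.sum_le_sum fun j _ => ?_
        rw [← mul_add, sub_mul]
        exact mul_le_mul_of_nonneg_left ((hsNorm_sub_le _ _).trans (add_le_add le_rfl (h3 j)))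
          (hpj j)
    _ ≤ √(Fintype.card ι : ℝ) * (1 / t * opNorm K) +
        √(Fintype.card ι : ℝ) * (1 / t * opNorm K) := by
        rw [Finset.sum_add_distrib, ← Finset.sum_mul]
        refine add_le_add (h1.trans (mul_le_mul_of_nonneg_left h2 hN)) ?_
        exact mul_le_mul_of_nonneg_right (sum_sqrt_le_sqrt_card hp hp1) (by positivity)
    _ = _ := by ring

/-- Both resolvents have leading term `K / t` against `ρ_j^{1/2}`, since the support of `ρ_j` lies
in that of `ρ`. The difference is `1 / t` times a difference of remainders, each of order `1 / t`.
-/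
lemma resolventDefect_le_inv_sq (hp : ∀ j, 0 < p j) (hp1 : ∑ j, p j = 1)
    (hρsum : ρ = ∑ j, p j • ρs j) {t : ℝ} (ht : 0 < t) :
    resolventDefect p (fun j => (hσs j).1.1) (fun j => (hρs j).1.1) hσ.1.1 hρ.1.1 K t ≤
      √(Fintype.card ι : ℝ) * opNorm K * ((minNonzeroEigenvalue ρ)⁻¹ +
        ∑ j, (p j)⁻¹ * (minNonzeroEigenvalue (ρs j))⁻¹) * (1 / t ^ 2) := by
  have h1 := sum_sqrt_mul_hsNorm_le (fun j => (hp j).le) (fun j => (hρs j).1) hρ.1 hρsum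
    (resolventRemainder hσ.1.1 hρ.1.1 K t)
  have h2 := hsNorm_resolventRemainder_le hσ hρ K ht
  have h3 := fun j => hsNorm_resolventRemainder_le (hσs j) (hρs j) K ht
  have hκ := opNorm_nonneg K
  have hN := Real.sqrt_nonneg (Fintype.card ι : ℝ)
  have hpj := fun j => Real.rpow_nonneg (hp j).le (1 / 2)
  have hpos := fun j => minNonzeroEigenvalue_pos (hρs j)
  have hN1 : 1 ≤ √(Fintype.card ι : ℝ) := by
    rw [Real.one_le_sqrt]
    have : Nonempty ι := by
      by_contra h
      rw [not_nonempty_iff] at h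
      simp at hp1
    exact_mod_cast Fintype.card_pos
  have hj : ∀ j, hsNorm ((resolventMul hσ.1.1 hρ.1.1 K t -
      resolventMul (hσs j).1.1 (hρs j).1.1 K t) * psdPow (ρs j) (1 / 2)) ≤
      1 / t * (hsNorm (resolventRemainder hσ.1.1 hρ.1.1 K t * psdPow (ρs j) (1 / 2)) +
        1 / t * (minNonzeroEigenvalue (ρs j))⁻¹ * opNorm K) := by
    intro j
    have hker := mulVec_eq_zero_of_sum hp (fun j => (hρs j).1) hρsum j
    have e1 : (resolventMul hσ.1.1 hρ.1.1 K t -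
        resolventMul (hσs j).1.1 (hρs j).1.1 K t) * psdPow (ρs j) (1 / 2) =
        (-(1 / t)) • (resolventRemainder hσ.1.1 hρ.1.1 K t * psdPow (ρs j) (1 / 2) -
          resolventRemainder (hσs j).1.1 (hρs j).1.1 K t * psdPow (ρs j) (1 / 2)) := by
      have e2 : ∀ Y Z : Matrix n n ℂ, Y - Z = (1 / t) • (t • Y - t • Z) := by
        intro Y Z
        rw [← smul_sub, smul_smul, one_div_mul_cancel ht.ne', one_smul]
      rw [e2, smul_resolventMul hσ.1 hρ.1 K ht, smul_resolventMul (hσs j).1 (hρs j).1 K ht]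
      simp only [smul_mul_assoc, sub_mul, mul_assoc, support_mul_psdPow hρ.1 (hρs j).1 hker,
        psdPow_mul_psdPow (hρs j).1, zero_add, neg_smul, ← smul_neg]
      congr 1
      abel
    rw [e1, hsNorm_smul, abs_neg, abs_of_pos (by positivity)]
    exact mul_le_mul_of_nonneg_left ((hsNorm_sub_le _ _).trans (add_le_add le_rfl (h3 j)))
      (by positivity)
  have hsum : ∑ j, p j ^ (1 / 2 : ℝ) * (minNonzeroEigenvalue (ρs j))⁻¹ ≤
      √(Fintype.card ι : ℝ) * ∑ j, (p j)⁻¹ * (minNonzeroEigenvalue (ρs j))⁻¹ := by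
    refine le_trans (Finset.sum_le_sum fun j _ => ?_)
      (le_mul_of_one_le_left (Finset.sum_nonneg fun j _ => ?_) hN1)
    · have hle1 : p j ≤ 1 := hp1 ▸ Finset.single_le_sum (fun j _ => (hp j).le) (Finset.mem_univ j)
      refine mul_le_mul_of_nonneg_right ?_ (inv_nonneg.mpr (hpos j).le)
      -- The generous `p_j^{1/2} ≤ 1 ≤ p_j⁻¹` brings the sum to the form of `D`, which also has to
      -- absorb `λ⁻¹` in the common-support case.
      exact (Real.rpow_le_one (hp j).le hle1 (by norm_num)).trans
        ((one_le_inv₀ (hp j)).mpr hle1)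
    · exact mul_nonneg (inv_nonneg.mpr (hp j).le) (inv_nonneg.mpr (hpos j).le)
  calc _ ≤ ∑ j, (1 / t * (p j ^ (1 / 2 : ℝ) * hsNorm (resolventRemainder hσ.1.1 hρ.1.1 K t *
          psdPow (ρs j) (1 / 2))) + 1 / t * (1 / t) * opNorm K *
          (p j ^ (1 / 2 : ℝ) * (minNonzeroEigenvalue (ρs j))⁻¹)) := by
        refine Finset.sum_le_sum fun j _ => ?_
        refine (mul_le_mul_of_nonneg_left (hj j) (hpj j)).trans_eq ?_
        ring
    _ ≤ 1 / t * (√(Fintype.card ι : ℝ) * (1 / t * (minNonzeroEigenvalue ρ)⁻¹ * opNorm K)) +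
        1 / t * (1 / t) * opNorm K * (√(Fintype.card ι : ℝ) *
          ∑ j, (p j)⁻¹ * (minNonzeroEigenvalue (ρs j))⁻¹) := by
        rw [Finset.sum_add_distrib, ← Finset.mul_sum, ← Finset.mul_sum]
        refine add_le_add (mul_le_mul_of_nonneg_left
          (h1.trans (mul_le_mul_of_nonneg_left h2 hN)) (by positivity)) ?_
        exact mul_le_mul_of_nonneg_left hsum (by positivity)
    _ = _ := by ring

end Mixture

/-! ### Splitting the integral and choosing the cutoff. -/

section Splitting

variable {β : ℝ} {φ : ℝ → ℝ}

/-- Disjointness is not required because the cutoffs may come in the wrong order (`T < 1`, when `E`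
is large); the pieces then overlap. -/
lemma setIntegral_union_le {f : ℝ → ℝ} {s t : Set ℝ} (hs : MeasurableSet s) (ht : MeasurableSet t)
    (hfs : IntegrableOn f s) (hft : IntegrableOn f t) (h0 : ∀ x ∈ t, 0 ≤ f x) :
    ∫ x in s ∪ t, f x ≤ (∫ x in s, f x) + ∫ x in t, f x := by
  rw [← Set.union_sdiff_self, setIntegral_union Set.disjoint_sdiff_right (ht.diff hs) hfs
    (hft.mono_set Set.sdiff_subset)]
  refine add_le_add le_rfl ?_
  exact setIntegral_mono_set hft ((ae_restrict_iff' ht).mpr (ae_of_all _ h0))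
    (Set.sdiff_subset.eventuallyLE)

lemma integral_rpow_mul_le (hβ0 : 0 < β) (hβ1 : β < 1) (hφ : ∀ t, 0 < t → 0 ≤ φ t)
    (hint : IntegrableOn (fun t => t ^ β * φ t) (Set.Ioi 0)) {A B l R : ℝ}
    (hA : ∀ t, 0 < t → φ t ≤ A * (1 / t)) (hB : ∀ t, 0 < t → φ t ≤ B * (1 / t ^ 2))
    (hl : 0 < l) (hR : 0 < R) :
    ∫ t in Set.Ioi 0, t ^ β * φ t ≤ A * l ^ β / β + B * R ^ (β - 1) / (1 - β) +
      ∫ t in Set.Icc l R, t ^ β * φ t := by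
  have hnn : ∀ t, 0 < t → 0 ≤ t ^ β * φ t := fun t ht =>
    mul_nonneg (Real.rpow_nonneg ht.le _) (hφ t ht)
  have hs1 : Set.Ioc 0 l ⊆ Set.Ioi (0 : ℝ) := fun t ht => ht.1
  have hs2 : Set.Icc l R ⊆ Set.Ioi (0 : ℝ) := fun t ht => hl.trans_le ht.1
  have hs3 : Set.Ioi R ⊆ Set.Ioi (0 : ℝ) := Set.Ioi_subset_Ioi hR.le
  have hcover : Set.Ioi (0 : ℝ) = (Set.Ioc 0 l ∪ Set.Ioi R) ∪ Set.Icc l R := by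
    ext t
    simp only [Set.mem_Ioi, Set.mem_union, Set.mem_Ioc, Set.mem_Icc]
    constructor
    · intro ht
      by_cases h1 : t ≤ l
      · exact Or.inl (Or.inl ⟨ht, h1⟩)
      · by_cases h2 : t ≤ R
        · exact Or.inr ⟨(not_le.mp h1).le, h2⟩
        · exact Or.inl (Or.inr (not_le.mp h2))
    · rintro ((h | h) | h)
      · exact h.1
      · exact hR.trans h
      · exact hl.trans_le h.1
  have h1 : ∫ t in Set.Ioc 0 l, t ^ β * φ t ≤ A * l ^ β / β := by
    have hI : IntegrableOn (fun t : ℝ => A * t ^ (β - 1)) (Set.Ioc 0 l) :=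
      ((intervalIntegrable_iff_integrableOn_Ioc_of_le hl.le).mp
        (intervalIntegral.intervalIntegrable_rpow' (by linarith))).const_mul A
    calc _ ≤ ∫ t in Set.Ioc 0 l, A * t ^ (β - 1) := by
          refine setIntegral_mono_on (hint.mono_set hs1) hI measurableSet_Ioc fun t ht => ?_
          refine (mul_le_mul_of_nonneg_left (hA t ht.1) (Real.rpow_nonneg ht.1.le _)).trans_eq ?_
          rw [Real.rpow_sub_one ht.1.ne']
          ring
      _ = _ := by
          rw [integral_const_mul, ← intervalIntegral.integral_of_le hl.le,
            integral_rpow (Or.inl (by linarith)), sub_add_cancel, Real.zero_rpow hβ0.ne', sub_zero,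
            mul_div_assoc]
  have h2 : ∫ t in Set.Ioi R, t ^ β * φ t ≤ B * R ^ (β - 1) / (1 - β) := by
    have hI : IntegrableOn (fun t : ℝ => B * t ^ (β - 2)) (Set.Ioi R) :=
      (integrableOn_Ioi_rpow_of_lt (by linarith) hR).const_mul B
    calc _ ≤ ∫ t in Set.Ioi R, B * t ^ (β - 2) := by
          refine setIntegral_mono_on (hint.mono_set hs3) hI measurableSet_Ioi fun t ht => ?_
          have ht0 : 0 < t := hR.trans ht
          refine (mul_le_mul_of_nonneg_left (hB t ht0) (Real.rpow_nonneg ht0.le _)).trans_eq ?_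
          rw [Real.rpow_sub ht0, Real.rpow_two]
          ring
      _ = _ := by
          rw [integral_const_mul, integral_Ioi_rpow_of_lt (by linarith) hR,
            show β - 2 + 1 = β - 1 by ring, mul_div_assoc, neg_div, ← div_neg, neg_sub]
  have hi1 := hint.mono_set hs1
  have hi2 := hint.mono_set hs2
  have hi3 := hint.mono_set hs3
  rw [hcover]
  refine (setIntegral_union_le (measurableSet_Ioc.union measurableSet_Ioi) measurableSet_Icc
    (hi1.union hi3) hi2 fun t ht => hnn t (hs2 ht)).trans ?_
  gcongr
  exact (setIntegral_union_le measurableSet_Ioc measurableSet_Ioi hi1 hi3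
    fun t ht => hnn t (hs3 ht)).trans (add_le_add h1 h2)

/-- This is Cauchy–Schwarz for `∫ √g` on an interval of length at most `R`, in the form `√g ≤ (δ + g
/ δ) / 2`; the choice `δ = √(G / R)` equalizes the two resulting terms. -/
lemma setIntegral_rpow_mul_le_sqrt {g : ℝ → ℝ} {a S l R G : ℝ} (ha : 0 ≤ a)
    (hint : IntegrableOn (fun t => t ^ β * φ t) (Set.Icc l R))
    (hg : ∀ t, 0 < t → 0 ≤ g t) (hgint : IntegrableOn g (Set.Icc l R))
    (hφ : ∀ t, 0 < t → φ t ≤ a * √(g t / t)) (hl : 0 < l) (hR : 0 < R) (hG : 0 < G)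
    (hS0 : 0 ≤ S) (hS : ∀ t ∈ Set.Icc l R, t ^ (β - 1 / 2) ≤ S)
    (hGint : ∫ t in Set.Icc l R, g t ≤ G) :
    ∫ t in Set.Icc l R, t ^ β * φ t ≤ a * (S * √(R * G)) := by
  set δ := √(G / R) with hδ
  have hδ0 : 0 < δ := Real.sqrt_pos.mpr (by positivity)
  have hI : IntegrableOn (fun t => a * S / 2 * (δ + g t / δ)) (Set.Icc l R) :=
    (((integrable_const δ).add (hgint.div_const δ))).const_mul _
  have hδR : δ * R = √(R * G) := by
    rw [hδ, Real.sqrt_div hG.le, Real.sqrt_mul hR.le]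
    have := Real.mul_self_sqrt hR.le
    have h2 : √R ≠ 0 := (Real.sqrt_pos.mpr hR).ne'
    field_simp
    rw [sq, this]
  have hGδ : G / δ = √(R * G) := by
    rw [div_eq_iff hδ0.ne', ← hδR, mul_right_comm, ← sq, hδ, Real.sq_sqrt (by positivity)]
    field_simp
  have hvol : (volume : Measure ℝ).real (Set.Icc l R) ≤ R := by
    rw [Measure.real, Real.volume_Icc]
    exact ENNReal.toReal_le_of_le_ofReal hR.le (ENNReal.ofReal_le_ofReal (by linarith))
  calc _ ≤ ∫ t in Set.Icc l R, a * S / 2 * (δ + g t / δ) := by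
        refine setIntegral_mono_on hint hI measurableSet_Icc fun t ht => ?_
        have ht0 : 0 < t := hl.trans_le ht.1
        have hg0 := hg t ht0
        have hamgm : √(g t) ≤ (δ + g t / δ) / 2 := by
          have h1 := Real.sq_sqrt hg0
          have h2 : g t / δ * δ = g t := div_mul_cancel₀ _ hδ0.ne'
          rw [le_div_iff₀ two_pos]
          refine le_of_mul_le_mul_right ?_ hδ0
          nlinarith [sq_nonneg (√(g t) - δ)]
        calc t ^ β * φ t ≤ t ^ β * (a * √(g t / t)) :=
              mul_le_mul_of_nonneg_left (hφ t ht0) (Real.rpow_nonneg ht0.le _)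
          _ = a * (t ^ (β - 1 / 2) * √(g t)) := by
              rw [Real.sqrt_div hg0, Real.rpow_sub ht0, ← Real.sqrt_eq_rpow]
              ring
          _ ≤ a * (S * ((δ + g t / δ) / 2)) := by
              gcongr
              exact hS t ht
          _ = _ := by ring
    _ = a * S / 2 * (δ * (volume : Measure ℝ).real (Set.Icc l R) +
          (∫ t in Set.Icc l R, g t) / δ) := by
        rw [integral_const_mul, integral_add (integrable_const δ) (hgint.div_const δ),
          integral_div, setIntegral_const, smul_eq_mul, mul_comm δ]
    _ ≤ a * S / 2 * (δ * R + G / δ) := by gcongr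
    _ = _ := by rw [hδR, hGδ]; ring

lemma exists_cutoff {c e C : ℝ} (hβ0 : 0 < β) (hβ1 : β < 1) (hc : 0 ≤ c) (he : 0 < e)
    (hC : 0 < C) : ∃ T : ℝ, 0 < T ∧ 0 < cutL β T ∧ 0 < cutR β T ∧
      ((cutL β T)⁻¹) ^ β = e ^ alphaExponent c β ∧ (cutR β T) ^ (β - 1) = e ^ alphaExponent c β ∧
      ∃ S : ℝ, 0 ≤ S ∧ (∀ t ∈ Set.Icc (cutL β T)⁻¹ (cutR β T), t ^ (β - 1 / 2) ≤ S) ∧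
        S * √(cutR β T * (C * T ^ (2 * c) * e)) = √C * e ^ alphaExponent c β := by
  have hsqrt : ∀ x : ℝ, √(C * e ^ x) = √C * e ^ (x / 2) := by
    intro x
    rw [Real.sqrt_mul hC.le, Real.sqrt_eq_rpow (e ^ x), ← Real.rpow_mul he.le]
    congr 2
    ring
  have hone : 0 < 1 - β := by linarith
  by_cases h : β ≤ 1 / 2
  · have hden : 0 < 1 + 2 * c * (1 - β) := by positivity
    -- With `T = e^(-γ)` both outer parts are `e^(γβ)` for any `γ`; this `γ` makes the middle part
    -- match. As `β ≤ 1/2`, `t^(β-1/2)` is largest at the left endpoint, which gives `S`.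
    set γ := (1 - β) / (1 + 2 * c * (1 - β)) with hγ
    have hT : 0 < e ^ (-γ) := Real.rpow_pos_of_pos he _
    refine ⟨e ^ (-γ), hT, ?_⟩
    simp only [cutL, cutR, alphaExponent, h, if_true]
    refine ⟨hT, Real.rpow_pos_of_pos hT _, ?_, ?_, (e ^ (-γ))⁻¹ ^ (β - 1 / 2), by positivity, ?_, ?_⟩
    · rw [← Real.rpow_neg he.le, ← Real.rpow_mul he.le]
      congr 1
      rw [hγ]; ring
    · rw [← Real.rpow_mul he.le, ← Real.rpow_mul he.le]
      congr 1
      rw [hγ]; field_simp; ring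
    · intro t ht
      exact Real.rpow_le_rpow_of_nonpos (inv_pos.mpr hT) ht.1 (by linarith)
    · have e1 : (e ^ (-γ)) ^ (β / (1 - β)) * (C * (e ^ (-γ)) ^ (2 * c) * e) =
          C * e ^ (-γ * (β / (1 - β)) + -γ * (2 * c) + 1) := by
        rw [Real.rpow_add he, Real.rpow_add he, Real.rpow_one, ← Real.rpow_mul he.le,
          ← Real.rpow_mul he.le]
        ring
      rw [e1, hsqrt, ← Real.rpow_neg he.le, ← Real.rpow_mul he.le, mul_left_comm,
        ← Real.rpow_add he]
      congr 2
      rw [hγ]; field_simp; ring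
  · have hden : 0 < 1 + c := by positivity
    -- Now the outer parts are `e^(γ(1-β))`, the middle part again fixes `γ`, and `S` is the value
    -- at the right endpoint.
    set γ := 1 / (2 * (1 + c)) with hγ
    have hT : 0 < e ^ (-γ) := Real.rpow_pos_of_pos he _
    refine ⟨e ^ (-γ), hT, ?_⟩
    simp only [cutL, cutR, alphaExponent, h, if_false]
    refine ⟨Real.rpow_pos_of_pos hT _, hT, ?_, ?_, (e ^ (-γ)) ^ (β - 1 / 2), by positivity, ?_, ?_⟩
    · rw [← Real.rpow_mul he.le, ← Real.rpow_neg he.le, ← Real.rpow_mul he.le]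
      congr 1
      rw [hγ]; field_simp
    · rw [← Real.rpow_mul he.le]
      congr 1
      rw [hγ]; field_simp; ring
    · intro t ht
      refine Real.rpow_le_rpow ?_ ht.2 (by linarith)
      exact (inv_nonneg.mpr (Real.rpow_nonneg hT.le _)).trans ht.1
    · have e1 : e ^ (-γ) * (C * (e ^ (-γ)) ^ (2 * c) * e) =
          C * e ^ (-γ + -γ * (2 * c) + 1) := by
        rw [Real.rpow_add he, Real.rpow_add he, Real.rpow_one, ← Real.rpow_mul he.le]
        ring
      rw [e1, hsqrt, ← Real.rpow_mul he.le, mul_left_comm, ← Real.rpow_add he]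
      congr 2
      rw [hγ]; field_simp; ring

lemma alphaExponent_pos {c : ℝ} (hβ0 : 0 < β) (hβ1 : β < 1) (hc : 0 ≤ c) :
    0 < alphaExponent c β := by
  have : 0 < 1 - β := by linarith
  rw [alphaExponent]
  split_ifs <;> positivity

end Splitting

/-! ### Assembly of the estimate. -/

section Main

variable {ι n : Type*} [Fintype ι] [Fintype n] [DecidableEq n] {p : ι → ℝ}
  {ρs σs : ι → Matrix n n ℂ} {ρ σ : Matrix n n ℂ}

omit [DecidableEq n] in
lemma IsState.sum (hp : ∀ j, 0 ≤ p j) (hp1 : ∑ j, p j = 1) (hρs : ∀ j, IsState (ρs j)) :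
    IsState (∑ j, p j • ρs j) := by
  refine ⟨Matrix.posSemidef_sum _ fun j _ => (hρs j).1.smul (hp j), ?_⟩
  rw [Matrix.trace_sum]
  simp only [Matrix.trace_smul, (hρs _).2]
  rw [← Finset.sum_smul, hp1, one_smul]

/-- If `f` has no finite limit at `0`, then `K` maps the support of each `ρs j` into that of `σs j`,
which lies in the support of `σ`. -/
lemma quasiRelEntropy_sum_ne_top {f : ℝ → ℝ} {K : Matrix n n ℂ} (hp : ∀ j, 0 < p j)
    (hρs : ∀ j, (ρs j).PosSemidef) (hσs : ∀ j, (σs j).PosSemidef) (hρ : ρ.PosSemidef)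
    (hσ : σ.PosSemidef) (hρsum : ρ = ∑ j, p j • ρs j) (hσsum : σ = ∑ j, p j • σs j)
    (hfin : ∀ j, quasiRelEntropy f K (ρs j) (σs j) ≠ ⊤) : quasiRelEntropy f K ρ σ ≠ ⊤ := by
  rw [quasiRelEntropy_eq hσ hρ]
  by_cases hlim : ∃ l : ℝ, Tendsto f (𝓝[>] (0 : ℝ)) (𝓝 l)
  · rw [if_pos (Or.inl hlim)]
    exact EReal.coe_ne_top _
  rw [if_pos]
  · exact EReal.coe_ne_top _
  right
  have hj : ∀ j, psdPow σ 0 * K * ρs j = K * ρs j := by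
    intro j
    have h1 := hfin j
    rw [quasiRelEntropy_eq (hσs j) (hρs j)] at h1
    have h2 : psdPow (σs j) 0 * K * ρs j = K * ρs j := by
      by_contra h
      exact h1 (if_neg (not_or.mpr ⟨hlim, h⟩))
    have h3 := support_mul_psdPow hσ (hσs j) (mulVec_eq_zero_of_sum hp hσs hσsum j) 0
    calc psdPow σ 0 * K * ρs j = psdPow σ 0 * (psdPow (σs j) 0 * K * ρs j) := by
          rw [h2, mul_assoc]
      _ = psdPow σ 0 * psdPow (σs j) 0 * K * ρs j := by simp only [mul_assoc]
      _ = K * ρs j := by rw [h3, h2]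
  rw [hρsum, Matrix.mul_sum, Matrix.mul_sum]
  exact Finset.sum_congr rfl fun j _ => by rw [mul_smul_comm, mul_smul_comm, hj]

lemma integrableOn_convexityGap (hσs : ∀ j, (σs j).PosSemidef) (hρs : ∀ j, (ρs j).PosSemidef)
    (hσ : σ.PosSemidef) (hρ : ρ.PosSemidef) (K : Matrix n n ℂ) {l : ℝ} (R : ℝ) (hl : 0 < l) :
    IntegrableOn (fun t => convexityGap p (fun j => (hσs j).1) (fun j => (hρs j).1) hσ.1 hρ.1 K
      (fun x => 1 / (t + x))) (Set.Icc l R) := by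
  obtain ⟨M, hM⟩ := exists_abs_convexityGap_le (p := p) hσs hρs hσ hρ K
  refine Measure.integrableOn_of_bounded (M := M * (1 / l)) (by simp) ?_ ?_
  · simp only [convexityGap, eigSum]
    fun_prop
  · refine (ae_restrict_iff' measurableSet_Icc).mpr (ae_of_all _ fun t ht => ?_)
    refine hM _ _ fun x hx => ?_
    have h1 : l ≤ t + x := by linarith [ht.1]
    rw [abs_of_nonneg (one_div_nonneg.mpr (hl.le.trans h1))]
    exact one_div_le_one_div_of_le hl h1

lemma sum_hsNorm_le_of_regularity {β c C E : ℝ} {f : ℝ → ℝ} (hβ0 : 0 < β) (hβ1 : β < 1)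
    (hf : IsRegularFunction f β) (hC : 0 < C) (hc : 0 ≤ c) (hE0 : 0 < E)
    (hreg : ∀ T : ℝ, 0 < T → regularityConst f β T < ENNReal.ofReal (C * T ^ (2 * c)))
    (hp : ∀ j, 0 < p j) (hp1 : ∑ j, p j = 1) (hσs : ∀ j, IsState (σs j))
    (hρs : ∀ j, IsState (ρs j)) (hσ : IsState σ) (hρ : IsState ρ) (K : Matrix n n ℂ)
    (hρsum : ρ = ∑ j, p j • ρs j) (hσsum : σ = ∑ j, p j • σs j) {E₀ : ℝ} (hE₀ : E₀ ≤ E)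
    (hE : Tendsto (fun ε => convexityGap p (fun j => (hσs j).1.1) (fun j => (hρs j).1.1) hσ.1.1
      hρ.1.1 K (fun x => f (x + ε))) (𝓝[>] 0) (𝓝 E₀)) :
    ∑ j, (p j) ^ (1 / 2 : ℝ) *
      hsNorm (psdPow σ β * K * psdPow ρ (-β) * psdPow (ρs j) (1 / 2)
        - psdPow (σs j) β * K * psdPow (ρs j) (1 / 2 - β)) ≤
      Real.sin (β * Real.pi) / Real.pi * √(Fintype.card ι : ℝ) *
        (2 * opNorm K / β + opNorm K * ((minNonzeroEigenvalue ρ)⁻¹ +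
          ∑ j, (p j)⁻¹ * (minNonzeroEigenvalue (ρs j))⁻¹) / (1 - β) + √C) *
        E ^ alphaExponent c β := by
  have hsin : 0 ≤ Real.sin (β * Real.pi) / Real.pi :=
    div_nonneg (Real.sin_nonneg_of_nonneg_of_le_pi (by positivity)
      (by nlinarith [Real.pi_pos])) Real.pi_pos.le
  have hpj := fun j => Real.rpow_nonneg (hp j).le (1 / 2)
  have hstep := fun j => hsNorm_psdPow_sub_le hσ.1 hρ.1 (hσs j).1 (hρs j).1 hβ0 hβ1 K
    (support_mul_psdPow hρ.1 (hρs j).1 (mulVec_eq_zero_of_sum hp (fun j => (hρs j).1) hρsum j) _)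
  set φ := resolventDefect p (fun j => (hσs j).1.1) (fun j => (hρs j).1.1) hσ.1.1 hρ.1.1 K with hφ
  have hφeq : (fun t => t ^ β * φ t) = fun t => ∑ j, p j ^ (1 / 2 : ℝ) * (t ^ β *
      hsNorm ((resolventMul hσ.1.1 hρ.1.1 K t -
        resolventMul (hσs j).1.1 (hρs j).1.1 K t) * psdPow (ρs j) (1 / 2))) := by
    ext t
    simp only [hφ, resolventDefect, Finset.mul_sum]
    exact Finset.sum_congr rfl fun j _ => by ring
  have hint : IntegrableOn (fun t => t ^ β * φ t) (Set.Ioi 0) := by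
    rw [hφeq]
    exact integrable_finsetSum _ fun j _ => (hstep j).1.const_mul _
  have hφ0 : ∀ t, 0 < t → 0 ≤ φ t := fun t _ =>
    Finset.sum_nonneg fun j _ => mul_nonneg (hpj j) (hsNorm_nonneg _)
  obtain ⟨T, hT, hL, hR, hLpow, hRpow, S, hS0, hS, hSeq⟩ := exists_cutoff hβ0 hβ1 hc hE0 hC
  have hμ := hf.isCanonicalMeasure hβ0 hβ1
  have hCT : 0 ≤ C * T ^ (2 * c) := by positivity
  have hgap := setIntegral_convexityGap_le (p := p) (fun j => (hσs j).1) (fun j => (hρs j).1) hσ.1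
    hρ.1 K hμ (fun j => (hp j).le) hρsum hσsum hE (inv_pos.mpr hL) hCT
    (volume_restrict_le_of_regularityConst_lt (hreg T hT))
  have hsplit := integral_rpow_mul_le hβ0 hβ1 hφ0 hint
    (fun t ht => resolventDefect_le_inv hσs hρs hσ hρ K (fun j => (hp j).le) hp1 hρsum ht)
    (fun t ht => resolventDefect_le_inv_sq hσs hρs hσ hρ K hp hp1 hρsum ht)
    (inv_pos.mpr hL) hR
  have hmid := setIntegral_rpow_mul_le_sqrt (Real.sqrt_nonneg (Fintype.card ι : ℝ))
    (hint.mono_set fun t ht => (inv_pos.mpr hL).trans_le ht.1)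
    (fun t ht => convexityGap_inv_add_nonneg (fun j => (hσs j).1) (fun j => (hρs j).1) hσ.1 hρ.1 K
      (fun j => (hp j).le) hρsum hσsum ht)
    (integrableOn_convexityGap (fun j => (hσs j).1) (fun j => (hρs j).1) hσ.1 hρ.1 K (cutR β T)
      (inv_pos.mpr hL))
    (fun t ht => resolventDefect_le_sqrt_gap hσs hρs hσ hρ K (fun j => (hp j).le) hρsum hσsum ht)
    (inv_pos.mpr hL) hR (by positivity : 0 < C * T ^ (2 * c) * E) hS0 hS
    (hgap.trans (mul_le_mul_of_nonneg_left hE₀ hCT))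
  rw [hSeq] at hmid
  rw [hLpow, hRpow] at hsplit
  calc _ ≤ ∑ j, p j ^ (1 / 2 : ℝ) * (Real.sin (β * Real.pi) / Real.pi * ∫ t in Set.Ioi 0, t ^ β *
        hsNorm ((resolventMul hσ.1.1 hρ.1.1 K t -
        resolventMul (hσs j).1.1 (hρs j).1.1 K t) * psdPow (ρs j) (1 / 2))) :=
        Finset.sum_le_sum fun j _ => mul_le_mul_of_nonneg_left (hstep j).2 (hpj j)
    _ = Real.sin (β * Real.pi) / Real.pi * ∫ t in Set.Ioi 0, t ^ β * φ t := by
        rw [hφeq, integral_finsetSum _ fun j _ => (hstep j).1.const_mul _, Finset.mul_sum]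
        refine Finset.sum_congr rfl fun j _ => ?_
        rw [integral_const_mul]
        ring
    _ ≤ _ := mul_le_mul_of_nonneg_left (hsplit.trans (add_le_add le_rfl hmid)) hsin
    _ = _ := by ring

/-- The cutoff is a negative power of `E`, which excludes `E = 0`, and the infimum defining the
regularity constant is not shown to be attained. Replacing `E` and `C` by `E + η` and `C + η` cures
both; the bound is continuous at `η = 0` because the exponent is positive. -/
lemma sum_hsNorm_le_errorConst {β c C E D : ℝ} {f : ℝ → ℝ} (hβ0 : 0 < β) (hβ1 : β < 1)
    (hf : IsRegularFunction f β) (hC : 0 < C) (hc : 0 ≤ c) (hE0 : 0 ≤ E)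
    (hreg : ∀ T : ℝ, 0 < T → regularityConst f β T ≤ ENNReal.ofReal (C * T ^ (2 * c)))
    (hp : ∀ j, 0 < p j) (hp1 : ∑ j, p j = 1) (hσs : ∀ j, IsState (σs j))
    (hρs : ∀ j, IsState (ρs j)) (hσ : IsState σ) (hρ : IsState ρ) (K : Matrix n n ℂ)
    (hρsum : ρ = ∑ j, p j • ρs j) (hσsum : σ = ∑ j, p j • σs j)
    (hE : Tendsto (fun ε => convexityGap p (fun j => (hσs j).1.1) (fun j => (hρs j).1.1) hσ.1.1
      hρ.1.1 K (fun x => f (x + ε))) (𝓝[>] 0) (𝓝 E))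
    (hD : (minNonzeroEigenvalue ρ)⁻¹ + ∑ j, (p j)⁻¹ * (minNonzeroEigenvalue (ρs j))⁻¹ ≤ 2 * D) :
    ∑ j, (p j) ^ (1 / 2 : ℝ) *
      hsNorm (psdPow σ β * K * psdPow ρ (-β) * psdPow (ρs j) (1 / 2)
        - psdPow (σs j) β * K * psdPow (ρs j) (1 / 2 - β)) ≤
      errorConst β C (Fintype.card ι) (opNorm K) D * E ^ alphaExponent c β := by
  have hsin : 0 ≤ Real.sin (β * Real.pi) / Real.pi :=
    div_nonneg (Real.sin_nonneg_of_nonneg_of_le_pi (by positivity)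
      (by nlinarith [Real.pi_pos])) Real.pi_pos.le
  have hα := alphaExponent_pos hβ0 hβ1 hc
  have hone : 0 < 1 - β := by linarith
  have hcont : Continuous fun η : ℝ =>
      errorConst β (C + η) (Fintype.card ι) (opNorm K) D * (E + η) ^ alphaExponent c β := by
    unfold errorConst
    exact (by fun_prop : Continuous _).mul
      ((continuous_const.add continuous_id).rpow_const fun _ => Or.inr hα.le)
  have hlim := (hcont.tendsto 0).mono_left (nhdsWithin_le_nhds (s := Set.Ioi 0))
  simp only [add_zero] at hlim
  refine ge_of_tendsto hlim ?_
  filter_upwards [self_mem_nhdsWithin] with η hη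
  have hη : 0 < η := hη
  refine (sum_hsNorm_le_of_regularity hβ0 hβ1 hf (by linarith : 0 < C + η) hc
    (by linarith : 0 < E + η) (fun T hT => (hreg T hT).trans_lt ?_) hp hp1 hσs hρs hσ hρ K hρsum
    hσsum (by linarith) hE).trans ?_
  · have hTc : 0 < T ^ (2 * c) := Real.rpow_pos_of_pos hT _
    rw [ENNReal.ofReal_lt_ofReal_iff (by positivity)]
    nlinarith
  · unfold errorConst
    have hκ := opNorm_nonneg K
    have : opNorm K * ((minNonzeroEigenvalue ρ)⁻¹ +
        ∑ j, (p j)⁻¹ * (minNonzeroEigenvalue (ρs j))⁻¹) ≤ 2 * opNorm K * D := by nlinarith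
    have hE1 : 0 ≤ E + η := by linarith
    gcongr

end Main

theorem corollary5p3 {ι n : Type*} [Fintype ι] [Fintype n] [DecidableEq n]
    (β : ℝ) (hβ0 : 0 < β) (hβ1 : β < 1)
    (f : ℝ → ℝ) (hf : IsRegularFunction f β) (hf1 : f 1 = 0)
    (C c : ℝ) (hC : 0 < C) (hc : 0 ≤ c)
    (hreg : ∀ T : ℝ, 0 < T → regularityConst f β T ≤ ENNReal.ofReal (C * T ^ (2 * c)))
    (K : Matrix n n ℂ)
    (p : ι → ℝ) (hp : ∀ j, 0 < p j) (hp1 : ∑ j, p j = 1)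
    (ρs σs : ι → Matrix n n ℂ) (hρs : ∀ j, IsState (ρs j)) (hσs : ∀ j, IsState (σs j))
    (ρ σ : Matrix n n ℂ) (hρ : ρ = ∑ j, p j • ρs j) (hσ : σ = ∑ j, p j • σs j)
    -- automatic if every `σs j` is invertible or `f` has a finite limit at `0`
    (hfin : ∀ j, quasiRelEntropy f K (ρs j) (σs j) ≠ ⊤)
    (E : ℝ) (hE : E = ∑ j, p j * (quasiRelEntropy f K (ρs j) (σs j)).toReal
      - (quasiRelEntropy f K ρ σ).toReal)
    (D : ℝ) (hD : D = ∑ j, (p j)⁻¹ * (minNonzeroEigenvalue (ρs j))⁻¹) :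
    quasiRelEntropy f K ρ σ ≠ ⊤ ∧ 0 ≤ E ∧
    -- invertible `ρs j`, or more generally `ρs j` with a common support
    ((∀ i j, ∀ v : n → ℂ, ρs i *ᵥ v = 0 → ρs j *ᵥ v = 0) →
      ∑ j, (p j) ^ (1 / 2 : ℝ) *
        hsNorm (psdPow σ β * K * psdPow ρ (-β) * psdPow (ρs j) (1 / 2)
          - psdPow (σs j) β * K * psdPow (ρs j) (1 / 2 - β))
        ≤ errorConst β C (Fintype.card ι) (opNorm K) D * E ^ alphaExponent c β) ∧
    -- the case `β = 1/2`
    (β = 1 / 2 → (∀ j, (ρs j).PosDef) →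
      ∑ j, (p j) ^ (1 / 2 : ℝ) *
        hsNorm (psdPow σ (1 / 2) * K * psdPow ρ (-(1 / 2)) * psdPow (ρs j) (1 / 2)
          - psdPow (σs j) (1 / 2) * K)
        ≤ errorConst (1 / 2) C (Fintype.card ι) (opNorm K) D * E ^ (1 / (4 * (c + 1)))) ∧
    -- arbitrary states
    ∑ j, (p j) ^ (1 / 2 : ℝ) *
      hsNorm (psdPow σ β * K * psdPow ρ (-β) * psdPow (ρs j) (1 / 2)
        - psdPow (σs j) β * K * psdPow (ρs j) (1 / 2 - β))
      ≤ errorConst β C (Fintype.card ι) (opNorm K) (D + (minNonzeroEigenvalue ρ)⁻¹)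
          * E ^ alphaExponent c β := by
  have hρ' : IsState ρ := hρ ▸ IsState.sum (fun j => (hp j).le) hp1 hρs
  have hσ' : IsState σ := hσ ▸ IsState.sum (fun j => (hp j).le) hp1 hσs
  have hμ := hf.isCanonicalMeasure hβ0 hβ1
  have htop := quasiRelEntropy_sum_ne_top hp (fun j => (hρs j).1) (fun j => (hσs j).1) hρ'.1 hσ'.1
    hρ hσ hfin
  have hshift : ∀ x, 0 < x → Tendsto (fun ε => f (x + ε)) (𝓝[>] 0) (𝓝 (f x)) :=
    fun x hx => hμ.tendsto_shift hx
  have hEtendsto : Tendsto (fun ε => convexityGap p (fun j => (hσs j).1.1) (fun j => (hρs j).1.1)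
      hσ'.1.1 hρ'.1.1 K (fun x => f (x + ε))) (𝓝[>] 0) (𝓝 E) := by
    rw [hE]
    exact (tendsto_finsetSum _ fun j _ =>
      (tendsto_eigSum_shift (hσs j).1 (hρs j).1 K hshift (hfin j)).const_mul _).sub
      (tendsto_eigSum_shift hσ'.1 hρ'.1 K hshift htop)
  have hE0 : 0 ≤ E := by
    refine ge_of_tendsto hEtendsto ?_
    filter_upwards [self_mem_nhdsWithin] with ε hε
    exact convexityGap_shift_nonneg (fun j => (hσs j).1) (fun j => (hρs j).1) hσ'.1 hρ'.1 K hμ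
      (fun j => (hp j).le) hρ hσ hε
  have hmin := fun j => minNonzeroEigenvalue_pos (hρs j)
  have hterm : ∀ j, 0 < (p j)⁻¹ * (minNonzeroEigenvalue (ρs j))⁻¹ := fun j =>
    mul_pos (inv_pos.mpr (hp j)) (inv_pos.mpr (hmin j))
  have hD0 : 0 ≤ D := hD ▸ Finset.sum_nonneg fun j _ => (hterm j).le
  have hbound := fun {D' : ℝ} => sum_hsNorm_le_errorConst (D := D') hβ0 hβ1 hf hC hc hE0 hreg hp hp1
    hσs hρs hσ' hρ' K hρ hσ hEtendsto
  rw [← hD] at hbound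
  have hcommon : (∀ i j, ∀ v : n → ℂ, ρs i *ᵥ v = 0 → ρs j *ᵥ v = 0) →
      ∑ j, (p j) ^ (1 / 2 : ℝ) *
        hsNorm (psdPow σ β * K * psdPow ρ (-β) * psdPow (ρs j) (1 / 2)
          - psdPow (σs j) β * K * psdPow (ρs j) (1 / 2 - β))
        ≤ errorConst β C (Fintype.card ι) (opNorm K) D * E ^ alphaExponent c β := by
    intro hsupp
    refine hbound ?_
    obtain ⟨j⟩ : Nonempty ι := by
      by_contra h
      rw [not_nonempty_iff] at h
      simp at hp1
    have hle : (ρ - p j • ρs j).PosSemidef := by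
      classical
      rw [hρ, ← Finset.sum_erase_eq_sub (Finset.mem_univ j)]
      exact Matrix.posSemidef_sum _ fun i _ => (hρs i).1.smul (hp i).le
    -- From `ρ ≥ p_j ρ_j` with equal supports, `λ ≥ p_j λ_j`. So `λ⁻¹` is at most a single term of
    -- `D`, which explains the factor `2 D` in the constant.
    have h1 := mul_minNonzeroEigenvalue_le hρ' (hρs j).1 (hp j).le hle fun v hv => by
      rw [hρ, Matrix.sum_mulVec]
      exact Finset.sum_eq_zero fun i _ => by rw [Matrix.smul_mulVec, hsupp j i v hv, smul_zero]
    have h2 : (minNonzeroEigenvalue ρ)⁻¹ ≤ D := by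
      refine (inv_anti₀ (mul_pos (hp j) (hmin j)) h1).trans ?_
      rw [mul_inv, hD]
      exact Finset.single_le_sum (f := fun j => (p j)⁻¹ * (minNonzeroEigenvalue (ρs j))⁻¹)
        (fun i _ => (hterm i).le) (Finset.mem_univ j)
    linarith
  refine ⟨htop, hE0, hcommon, ?_, hbound ?_⟩
  · intro hβ hpd
    have hker : ∀ i j, ∀ v : n → ℂ, ρs i *ᵥ v = 0 → ρs j *ᵥ v = 0 := by
      intro i j v hv
      have : v = 0 := Matrix.mulVec_injective_of_isUnit (hpd i).isUnit (by simpa using hv)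
      rw [this, Matrix.mulVec_zero]
    have h := hcommon hker
    subst hβ
    have hexp : alphaExponent c (1 / 2) = 1 / (4 * (c + 1)) := by
      have : 0 < c + 1 := by linarith
      rw [alphaExponent, if_pos le_rfl]
      field_simp
      ring
    have hzero : ∀ j, psdPow (ρs j) (1 / 2 - 1 / 2) = 1 := by
      intro j
      have h1 := psdPow_mul_psdPow (hρs j).1 1 0
      rw [add_zero, psdPow_one (hρs j).1] at h1
      rw [sub_self]
      exact (hpd j).isUnit.mul_left_cancel (h1.trans (mul_one _).symm)
    simpa only [hexp, hzero, mul_one] using h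
  · have := inv_pos.mpr (minNonzeroEigenvalue_pos hρ')
    linarith
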